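/- Let $p$ be a prime and let $(S,\mathcal F,\mathcal L)$ be a $p$-local finite group: $S$ is a finite $p$-group, $\mathcal F$ is a saturated fusion system over $S$, and $\mathcal L$ is a centric linking system associated to $\mathcal F$, with structure functors $\delta:\mathcal T_S^c(S)\to\mathcal L$ and $\pi:\mathcal L\to\mathcal F$. Assume that $\mathcal F$ is constrained, i.e. the largest subgroup $O_p(\mathcal F)$ of $S$ that is normal in $\mathcal F$ is $\mathcal F$-centric. Put $\pi_{\mathcal L}=\pi_1(|\mathcal L|,S)$ and, for $P$ an $\mathcal F$-centric subgroup, $\iota_P=\delta(1)\in\mathrm{Mor}_{\mathcal L}(P,S)$. For $\psi\in\mathrm{Mor}_{\mathcal L}(P,Q)$ let $\omega(\psi)\in\pi_{\mathcal L}$ be the class of the loop that runs along $\iota_P$ backwards, then along $\psi$, then along $\iota_Q$. Every $\mathbb Z_{(p)}[\pi_{\mathcal L}]$-module $M$ is a $\mathbb Z_{(p)}[S]$-module through $g\mapsto\omega(\delta_S(g))$. For $P$ an $\mathcal F$-centric subgroup and $\varphi\in\mathrm{Hom}_{\mathcal F}(P,S)$, let $\varphi^*:H^*(S,M)\to H^*(P,M)$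 be the map induced by the pair $(\varphi,\omega(\psi)^{-1})$ for any $\psi\in\mathrm{Mor}_{\mathcal L}(P,S)$ with $\pi(\psi)=\varphi$ (it does not depend on $\psi$), and let $$H^*(\mathcal F^c,M)=\{x\in H^*(S,M)\;:\;\varphi^*(x)=\mathrm{Res}^S_P(x)\text{ for all }\mathcal F\text{-centric }P\le S\text{ and all }\varphi\in\mathrm{Hom}_{\mathcal F}(P,S)\}.$$ For $P\le S$ and $\varphi\in\mathrm{Hom}_{\mathcal F}(P,S)$ let $[P,\varphi]$ be the transitive $(S,S)$-biset $(S\times S)/\{(u,\varphi(u)):u\in P\}$. A finite left-free $(S,S)$-biset $\Omega$ is $\mathcal F$-characteristic if it is a disjoint union of bisets isomorphic to such $[P,\varphi]$; if for all $P\le S$ and $\varphi\in\mathrm{Hom}_{\mathcal F}(P,S)$ the $(P,S)$-bisets obtained from $\Omega$ by restricting the left action along $\varphi$ and along the inclusion $P\le S$ are isomorphic, and likewise for the $(S,P)$-bisets obtained by restricting the right action; and if $|\Omega|/|S|$ is prime to $p$. Let $\Omega$ be the minimal $\mathcal F$-characteristic $(S,S)$-biset, i.e. an $\mathcal F$-characteristic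 biset no proper sub-biset of which is $\mathcal F$-characteristic. Then every transitive component $[P,\varphi]$ of $\Omega$ has $P$ $\mathcal F$-centric, so that for every $\mathbb Z_{(p)}[\pi_{\mathcal L}]$-module $M$ the endomorphism $\Omega_*=\sum \mathrm{tr}_P^S\circ\varphi^*$ of $H^*(S,M)$ (the sum over the transitive components $[P,\varphi]$ of $\Omega$) is defined; $|S|/|\Omega|$ lies in $\mathbb Z_{(p)}$; and for every such $M$ the map $\frac{|S|}{|\Omega|}\Omega_*\in\mathrm{End}(H^*(S,M))$ is an idempotent whose image is exactly $H^*(\mathcal F^c,M)$. -/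

import Mathlib

universe u v

noncomputable section

namespace PLocal

section Nerve

open CategoryTheory Simplicial Opposite

/-- The characteristic map `Δⁿ → |X|` of an `n`-simplex `x` of a simplicial set `X`. -/
def simplexMap (X : SSet.{u}) {n : ℕ} (x : X _⦋n⦌) : C(stdSimplex ℝ (Fin (n + 1)), |X|) :=
  TopCat.toSSetObjEquiv _ (op ⦋n⦌) ((sSetTopAdj.unit.app X).app (op ⦋n⦌) x)

lemma simplexMap_δ (X : SSet.{u}) {n : ℕ} (x : X _⦋n + 1⦌) (i : Fin (n + 2))
    (z : stdSimplex ℝ (Fin (n + 1))) :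
    simplexMap X (X.δ i x) z = simplexMap X x (stdSimplex.map i.succAbove z) := by
  have h := SSet.δ_naturality_apply (sSetTopAdj.unit.app X) i x
  rw [simplexMap]
  erw [h]
  exact TopCat.toSSetObjEquiv_δ_apply _ _ _

/-- The path in `stdSimplex ℝ (Fin 2)` from vertex `0` to vertex `1`. -/
def simplexPath : Path (stdSimplex.vertex (S := ℝ) (0 : Fin 2)) (stdSimplex.vertex (S := ℝ) (1 : Fin 2)) where
  toFun t := stdSimplexHomeomorphUnitInterval.symm t
  continuous_toFun := by fun_prop
  source' := by rw [Homeomorph.symm_apply_eq]; rfl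
  target' := by rw [Homeomorph.symm_apply_eq]; rfl

variable {C : Type u} [Category.{u} C]

/-- The vertex of `|C|` given by the object `P`. -/
def nerveVertex (P : C) : |nerve C| := simplexMap (nerve C) (n := 0) (ComposableArrows.mk₀ P) (stdSimplex.vertex 0)

lemma simplexMap_vertex_zero {P Q : C} (f : P ⟶ Q) :
    simplexMap (nerve C) (n := 1) (ComposableArrows.mk₁ f) (stdSimplex.vertex 0) = nerveVertex P := by
  have h : (nerve C).δ (n := 0) 1 (ComposableArrows.mk₁ f) = ComposableArrows.mk₀ P := ComposableArrows.ext₀ rfl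
  rw [nerveVertex, ← h]
  refine Eq.trans ?_ (simplexMap_δ (nerve C) (n := 0) (ComposableArrows.mk₁ f) 1 _).symm
  rw [stdSimplex.map_vertex]
  rfl

lemma simplexMap_vertex_one {P Q : C} (f : P ⟶ Q) :
    simplexMap (nerve C) (n := 1) (ComposableArrows.mk₁ f) (stdSimplex.vertex 1) = nerveVertex Q := by
  have h : (nerve C).δ (n := 0) 0 (ComposableArrows.mk₁ f) = ComposableArrows.mk₀ Q := ComposableArrows.ext₀ rfl
  rw [nerveVertex, ← h]
  refine Eq.trans ?_ (simplexMap_δ (nerve C) (n := 0) (ComposableArrows.mk₁ f) 0 _).symm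
  rw [stdSimplex.map_vertex]
  rfl

/-- The edge of `|C|` given by the morphism `f`. -/
def nerveEdge {P Q : C} (f : P ⟶ Q) : Path (nerveVertex P) (nerveVertex Q) :=
  (simplexPath.map (simplexMap (nerve C) (n := 1) (ComposableArrows.mk₁ f)).continuous).cast
    (simplexMap_vertex_zero f).symm (simplexMap_vertex_one f).symm

lemma homotopic_cast {X : Type*} [TopologicalSpace X] {a b c a' b' c' : X} (ha : a' = a)
    (hb : b' = b) (hc : c' = c) {p : Path a b} {q : Path b c} {r : Path a c}
    (h : r.Homotopic (p.trans q)) :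
    (r.cast ha hc).Homotopic ((p.cast ha hb).trans (q.cast hb hc)) := by
  subst ha hb hc; exact h

lemma nerveEdge_comp {P Q R : C} (f : P ⟶ Q) (g : Q ⟶ R) :
    (nerveEdge (f ≫ g)).Homotopic ((nerveEdge f).trans (nerveEdge g)) := by
  set c := simplexMap (nerve C) (n := 2) (ComposableArrows.mk₂ f g) with hc
  have : ContractibleSpace (stdSimplex ℝ (Fin 3)) :=
    (convex_stdSimplex ℝ (Fin 3)).contractibleSpace ⟨_, (stdSimplex.vertex (S := ℝ) (0 : Fin 3)).2⟩
  have key : ∀ (i : Fin 3) (t : unitInterval), simplexMap (nerve C) (n := 1) ((nerve C).δ i (ComposableArrows.mk₂ f g))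
     (stdSimplexHomeomorphUnitInterval.symm t) = c (stdSimplex.map i.succAbove (simplexPath t)) :=
    fun i t => simplexMap_δ _ _ _ _
  let e (i : Fin 3) := simplexPath.map (stdSimplex.continuous_map (S := ℝ) i.succAbove)
  let e' (i : Fin 3) : Path (stdSimplex.vertex (S := ℝ) (i.succAbove 0)) (stdSimplex.vertex (S := ℝ) (i.succAbove 1)) :=
    (e i).cast (stdSimplex.map_vertex _ _).symm (stdSimplex.map_vertex _ _).symm
  let e2 : Path (stdSimplex.vertex (S := ℝ) (0 : Fin 3)) (stdSimplex.vertex (S := ℝ) (1 : Fin 3)) := e' 2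
  let e0 : Path (stdSimplex.vertex (S := ℝ) (1 : Fin 3)) (stdSimplex.vertex (S := ℝ) (2 : Fin 3)) := e' 0
  let e1 : Path (stdSimplex.vertex (S := ℝ) (0 : Fin 3)) (stdSimplex.vertex (S := ℝ) (2 : Fin 3)) := e' 1
  have h : e1.Homotopic (e2.trans e0) := SimplyConnectedSpace.paths_homotopic _ _
  have hf : ∀ t, c (e2 t) = nerveEdge f t := fun t => by
    refine (key 2 t).symm.trans ?_
    rw [nerve.δ₂_mk₂_eq f g]; rfl
  have hg : ∀ t, c (e0 t) = nerveEdge g t := fun t => by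
    refine (key 0 t).symm.trans ?_
    rw [nerve.δ₀_mk₂_eq f g]; rfl
  have hfg : ∀ t, c (e1 t) = nerveEdge (f ≫ g) t := fun t => by
    refine (key 1 t).symm.trans ?_
    rw [nerve.δ₁_mk₂_eq f g]; rfl
  have hP : nerveVertex P = c (stdSimplex.vertex 0) := by simpa using (hf 0).symm
  have hQ : nerveVertex Q = c (stdSimplex.vertex 1) := by simpa using (hf 1).symm
  have hR : nerveVertex R = c (stdSimplex.vertex 2) := by simpa using (hg 1).symm
  have hm : (e1.map c.continuous).Homotopic ((e2.map c.continuous).trans (e0.map c.continuous)) := by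
    rw [← Path.map_trans]; exact h.map c
  have := homotopic_cast hP hQ hR hm
  convert this using 2
  · ext t; exact (hfg t).symm
  · ext t; exact (hf t).symm
  · ext t; exact (hg t).symm

/-- The homotopy class of the edge of `|C|` given by the morphism `f`. -/
def edgeClass {P Q : C} (f : P ⟶ Q) :
    FundamentalGroupoid.mk (nerveVertex P) ⟶ FundamentalGroupoid.mk (nerveVertex Q) :=
  ⟦nerveEdge f⟧

lemma edgeClass_comp {P Q R : C} (f : P ⟶ Q) (g : Q ⟶ R) :
    edgeClass (f ≫ g) = edgeClass f ≫ edgeClass g :=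
  Quotient.sound (s := Path.Homotopic.setoid _ _) (nerveEdge_comp f g)

lemma edgeClass_id (P : C) : edgeClass (𝟙 P) = 𝟙 _ := by
  have h := edgeClass_comp (𝟙 P) (𝟙 P)
  rw [Category.comp_id] at h
  rw [← cancel_epi (edgeClass (𝟙 P)), ← h, Category.comp_id]

end Nerve

section Fusion

variable {S : Type u} [Group S]

/-- A fusion system over `S`: the objects are all subgroups of `S`, a morphism `P → Q` is an
injective group homomorphism, composition is composition of homomorphisms, all conjugation maps by
elements of `S` are morphisms, and each morphism is an isomorphism of the fusion system followed by
an inclusion. (Identities and inclusions are the conjugation maps by `1`.) -/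
structure FusionSystem (S : Type u) [Group S] where
  Hom : ∀ P Q : Subgroup S, Set (P →* Q)
  injective : ∀ {P Q : Subgroup S} {φ : P →* Q}, φ ∈ Hom P Q → Function.Injective φ
  conj_mem : ∀ {P Q : Subgroup S} (φ : P →* Q) (g : S),
    (∀ x : P, (φ x : S) = g * x * g⁻¹) → φ ∈ Hom P Q
  comp_mem : ∀ {P Q R : Subgroup S} {φ : P →* Q} {ψ : Q →* R},
    φ ∈ Hom P Q → ψ ∈ Hom Q R → ψ.comp φ ∈ Hom P R
  factor : ∀ {P Q : Subgroup S} {φ : P →* Q}, φ ∈ Hom P Q →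
    ∃ (R : Subgroup S) (hR : R ≤ Q) (e : P ≃* R), e.toMonoidHom ∈ Hom P R ∧
      e.symm.toMonoidHom ∈ Hom R P ∧ φ = (Subgroup.inclusion hR).comp e.toMonoidHom

namespace FusionSystem

variable (F : FusionSystem S)

/-- `e` is an isomorphism of the fusion system. -/
def IsIso {P Q : Subgroup S} (e : P ≃* Q) : Prop :=
  e.toMonoidHom ∈ F.Hom P Q ∧ e.symm.toMonoidHom ∈ F.Hom Q P

lemma isIso_of_mem {P : Subgroup S} {e : P ≃* P} (he : e.toMonoidHom ∈ F.Hom P P) :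
    F.IsIso e := by
  obtain ⟨R, hR, e', h1, h2, h3⟩ := F.factor he
  have h4 : ∀ x, (e x : S) = e' x := fun x => congrArg Subtype.val (DFunLike.congr_fun h3 x)
  have hRP : R = P := le_antisymm hR fun x hx => by
    have := h4 (e.symm ⟨x, hx⟩)
    rw [e.apply_symm_apply] at this
    exact (congrArg (· ∈ R) this).mpr (e' _).2
  subst hRP
  obtain rfl : e = e' := MulEquiv.ext fun x => Subtype.ext (h4 x)
  exact ⟨h1, h2⟩

/-- `P` and `Q` are conjugate in the fusion system. -/
def IsConj (P Q : Subgroup S) : Prop := ∃ e : P ≃* Q, F.IsIso e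

/-- The group of automorphisms of `P` in the fusion system. -/
def autF (P : Subgroup S) : Subgroup (MulAut P) where
  carrier := {e | e.toMonoidHom ∈ F.Hom P P}
  one_mem' := F.conj_mem _ 1 fun x => by simp
  mul_mem' {a b} ha hb := F.comp_mem hb ha
  inv_mem' {_} ha := (F.isIso_of_mem ha).2

end FusionSystem

/-- The group of automorphisms of `P` induced by conjugation in `S`. -/
def autS (P : Subgroup S) : Subgroup (MulAut P) := P.normalizerMonoidHom.range

/-- For `φ : Q ≃* P`, the subgroup of all `g` in the normalizer of `Q` in `S` such that `φ c_g φ⁻¹`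
is induced by conjugation in `S`. -/
def extensionSubgroup {P Q : Subgroup S} (φ : Q ≃* P) : Subgroup S :=
  ((autS P).comap ((MulAut.congr φ).toMonoidHom.comp Q.normalizerMonoidHom)).map
    (Subgroup.normalizer (Q : Set S)).subtype

namespace FusionSystem

variable (F : FusionSystem S)

/-- `P` is fully automized: `Aut_S(P)` is a Sylow `p`-subgroup of `Aut_F(P)`. -/
def IsFullyAutomized (p : ℕ) (P : Subgroup S) : Prop :=
  ∃ T : Sylow p (F.autF P), (T : Subgroup (F.autF P)) = (autS P).subgroupOf (F.autF P)

/-- `P` is receptive: each isomorphism `φ : Q → P` of the fusion system extends to a morphism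
`N_φ → S`. -/
def IsReceptive (P : Subgroup S) : Prop :=
  ∀ (Q : Subgroup S) (φ : Q ≃* P), F.IsIso φ →
    ∃ ψ ∈ F.Hom (extensionSubgroup φ) ⊤, ∀ (x : S) (hx : x ∈ Q) (hx' : x ∈ extensionSubgroup φ),
      (ψ ⟨x, hx'⟩ : S) = φ ⟨x, hx⟩

/-- A fusion system is saturated if each subgroup is conjugate to one that is fully automized and
receptive. -/
def IsSaturated (p : ℕ) : Prop :=
  ∀ P : Subgroup S, ∃ Q : Subgroup S, F.IsConj P Q ∧ F.IsFullyAutomized p Q ∧ F.IsReceptive Q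

/-- `P` is centric: `C_S(Q) = Z(Q)` for each conjugate `Q` of `P`. -/
def IsCentric (P : Subgroup S) : Prop :=
  ∀ Q : Subgroup S, F.IsConj P Q →
    Subgroup.centralizer (Q : Set S) = (Subgroup.center Q).map Q.subtype

/-- `P` is fully centralized: its centralizer is largest among those of its conjugates. -/
def IsFullyCentralized (P : Subgroup S) : Prop :=
  ∀ Q : Subgroup S, F.IsConj P Q →
    Nat.card (Subgroup.centralizer (Q : Set S)) ≤ Nat.card (Subgroup.centralizer (P : Set S))

/-- `Q` is normal in the fusion system. -/
def IsNormal (Q : Subgroup S) : Prop :=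
  Q.Normal ∧ ∀ (P R : Subgroup S), ∀ φ ∈ F.Hom P R, ∃ ψ ∈ F.Hom (P ⊔ Q) (R ⊔ Q),
    (∀ (x : S) (hx : x ∈ P), (ψ ⟨x, le_sup_left (a := P) hx⟩ : S) = φ ⟨x, hx⟩) ∧
    ((Q.subgroupOf (P ⊔ Q)).map ψ).map (R ⊔ Q).subtype = Q

/-- The fusion system is constrained: its largest normal subgroup `O_p(F)` is centric. -/
def IsConstrained : Prop :=
  ∃ Q : Subgroup S, IsGreatest {R | F.IsNormal R} Q ∧ F.IsCentric Q

/-- The centric subgroups of `S`. -/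
structure Centric where
  toSubgroup : Subgroup S
  isCentric : F.IsCentric toSubgroup

lemma isCentric_top [Finite S] : F.IsCentric ⊤ := by
  rintro Q ⟨e, -⟩
  obtain rfl : Q = ⊤ := Q.eq_top_of_card_eq (by
    rw [← Nat.card_congr e.toEquiv, Subgroup.card_top])
  ext x
  simp [Subgroup.mem_centralizer_iff, Subgroup.mem_center_iff]

/-- `S` as a centric subgroup. -/
abbrev centricTop [Finite S] : F.Centric := ⟨⊤, F.isCentric_top⟩

lemma Centric.isFullyCentralized {F : FusionSystem S} (P : F.Centric) :
    F.IsFullyCentralized P.toSubgroup := by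
  intro Q hQ
  have hP : F.IsConj P.toSubgroup P.toSubgroup :=
    ⟨MulEquiv.refl _, F.conj_mem _ 1 fun x => by simp, F.conj_mem _ 1 fun x => by simp⟩
  rw [P.isCentric Q hQ, P.isCentric _ hP]
  obtain ⟨e, -⟩ := hQ
  refine le_of_eq ?_
  rw [Subgroup.card_subtype, Subgroup.card_subtype]
  exact Nat.card_congr (Subgroup.centerCongr e).symm.toEquiv

end FusionSystem

end Fusion

section Linking

open CategoryTheory Simplicial

variable {S : Type u} [Group S] (F : FusionSystem S) [Category.{u} F.Centric]

/-- The structure of a centric linking system associated to `F` on a category `L` whose objects are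
the centric subgroups of `S`: `L` is finite, and there are functors `δ` from the transporter
category of `S` on the centric subgroups (whose morphisms `P ⟶ Q` are the `g` in `S` with
`g P g⁻¹ ≤ Q`) to `L` and `π` from `L` to `F`, which are the identity on objects and satisfy the
axioms (A), (B), (C). -/
structure LinkingSystem where
  finite_hom : ∀ P Q : F.Centric, Finite (P ⟶ Q)
  δ : ∀ (P Q : F.Centric) (g : S), (∀ x ∈ P.toSubgroup, g * x * g⁻¹ ∈ Q.toSubgroup) → (P ⟶ Q)
  δ_one : ∀ (P : F.Centric) (h), δ P P 1 h = 𝟙 P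
  δ_mul : ∀ (P Q R : F.Centric) (g g' : S) (h) (h') (h''),
    δ P R (g' * g) h'' = δ P Q g h ≫ δ Q R g' h'
  π : ∀ {P Q : F.Centric}, (P ⟶ Q) → (P.toSubgroup →* Q.toSubgroup)
  π_mem : ∀ {P Q : F.Centric} (ψ : P ⟶ Q), π ψ ∈ F.Hom P.toSubgroup Q.toSubgroup
  π_id : ∀ P : F.Centric, π (𝟙 P) = MonoidHom.id P.toSubgroup
  π_comp : ∀ {P Q R : F.Centric} (ψ : P ⟶ Q) (χ : Q ⟶ R), π (ψ ≫ χ) = (π χ).comp (π ψ)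
  /-- (A): for `P` fully centralized, `C_S(P)` acts freely on the morphisms `P ⟶ Q`. -/
  free : ∀ {P Q : F.Centric}, F.IsFullyCentralized P.toSubgroup → ∀ (ψ : P ⟶ Q) (g : S) (h),
    g ∈ Subgroup.centralizer (P.toSubgroup : Set S) → δ P P g h ≫ ψ = ψ → g = 1
  /-- (A): two morphisms have the same image under `π` iff they are in one orbit. -/
  orbit : ∀ {P Q : F.Centric}, F.IsFullyCentralized P.toSubgroup → ∀ ψ χ : P ⟶ Q,
    π ψ = π χ ↔ ∃ (g : S) (_ : g ∈ Subgroup.centralizer (P.toSubgroup : Set S)) (h : _),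
      χ = δ P P g h ≫ ψ
  /-- (A): `π` maps onto the morphisms of `F`. -/
  surjective : ∀ {P Q : F.Centric}, F.IsFullyCentralized P.toSubgroup →
    ∀ φ ∈ F.Hom P.toSubgroup Q.toSubgroup, ∃ ψ : P ⟶ Q, π ψ = φ
  /-- (B) -/
  π_δ : ∀ (P Q : F.Centric) (g : S) (h) (x : P.toSubgroup), (π (δ P Q g h) x : S) = g * x * g⁻¹
  /-- (C) -/
  δ_comp : ∀ {P Q : F.Centric} (ψ : P ⟶ Q) (g : P.toSubgroup) (h) (h'),
    ψ ≫ δ Q Q (π ψ g : S) h' = δ P P (g : S) h ≫ ψ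

namespace LinkingSystem

variable [Finite S] {F} (L : LinkingSystem F)

/-- The fundamental group `π_L = π₁(|L|, S)`. -/
abbrev Pi (_L : LinkingSystem F) : Type u :=
  FundamentalGroup |nerve F.Centric| (nerveVertex F.centricTop)

/-- `ι_P`, the morphism `δ(1)` from `P` to `S` in `L`. -/
def incl (P : F.Centric) : P ⟶ F.centricTop := L.δ P F.centricTop 1 fun _ _ => Subgroup.mem_top _

/-- `δ_S(g)`, the automorphism of `S` in `L` given by `g`. -/
def autTop (g : S) : F.centricTop ⟶ F.centricTop :=
  L.δ F.centricTop F.centricTop g fun _ _ => Subgroup.mem_top _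

lemma autTop_one : L.autTop 1 = 𝟙 _ := L.δ_one _ _

lemma autTop_mul (g g' : S) : L.autTop (g * g') = L.autTop g' ≫ L.autTop g :=
  L.δ_mul _ _ _ _ _ _ _ _

/-- `ω` sends a morphism `ψ : P ⟶ Q` of `L` to the class of the loop at `S` that runs along `ι_P`
backwards, then along `ψ`, then along `ι_Q`. -/
def ω {P Q : F.Centric} (ψ : P ⟶ Q) : L.Pi :=
  Groupoid.inv (edgeClass (L.incl P)) ≫ edgeClass ψ ≫ edgeClass (L.incl Q)

lemma ω_id (P : F.Centric) : L.ω (𝟙 P) = 1 := by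
  rw [ω, edgeClass_id, Category.id_comp, Groupoid.inv_comp]
  rfl

lemma ω_comp {P Q R : F.Centric} (ψ : P ⟶ Q) (χ : Q ⟶ R) : L.ω (ψ ≫ χ) = L.ω χ * L.ω ψ := by
  rw [End.mul_def, ω, ω, ω, edgeClass_comp]
  simp only [Category.assoc]
  rw [← Category.assoc (edgeClass (L.incl Q)) (Groupoid.inv (edgeClass (L.incl Q))),
    Groupoid.comp_inv, Category.id_comp]

/-- The homomorphism `S → π_L` given by `ω ∘ δ_S`. -/
def fromS : S →* L.Pi where
  toFun g := L.ω (L.autTop g)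
  map_one' := by rw [autTop_one, ω_id]
  map_mul' g g' := by rw [autTop_mul, ω_comp]

lemma ω_incl (P : F.Centric) : L.ω (L.incl P) = 1 := by
  have h : L.incl F.centricTop = 𝟙 _ := L.δ_one _ _
  rw [ω, h, edgeClass_id, Category.comp_id, Groupoid.inv_comp]
  rfl

/-- `ω(δ_P(g)) = ω(δ_S(g))`. -/
lemma ω_δ (P : F.Centric) (g : S) (h) : L.ω (L.δ P P g h) = L.fromS g := by
  have h1 : L.δ P P g h ≫ L.incl P = L.incl P ≫ L.autTop g := by
    refine (L.δ_mul P P F.centricTop g 1 h _ fun _ _ => Subgroup.mem_top _).symm.trans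
      (Eq.trans ?_ (L.δ_mul P F.centricTop F.centricTop 1 g _ _ fun _ _ => Subgroup.mem_top _))
    simp only [one_mul, mul_one]
  have h2 := congrArg L.ω h1
  rw [L.ω_comp, L.ω_comp, L.ω_incl, one_mul, mul_one] at h2
  exact h2

lemma fromS_mul_ω {P Q : F.Centric} (ψ : P ⟶ Q) (g : P.toSubgroup) :
    L.fromS (L.π ψ g : S) * L.ω ψ = L.ω ψ * L.fromS (g : S) := by
  have hQ : ∀ x ∈ Q.toSubgroup, (L.π ψ g : S) * x * (L.π ψ g : S)⁻¹ ∈ Q.toSubgroup := fun x hx =>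
    mul_mem (mul_mem (L.π ψ g).2 hx) (inv_mem (L.π ψ g).2)
  have hP : ∀ x ∈ P.toSubgroup, (g : S) * x * (g : S)⁻¹ ∈ P.toSubgroup := fun x hx =>
    mul_mem (mul_mem g.2 hx) (inv_mem g.2)
  rw [← L.ω_δ Q _ hQ, ← L.ω_δ P _ hP, ← L.ω_comp, ← L.ω_comp]
  exact congrArg L.ω (L.δ_comp ψ g hP hQ)

end LinkingSystem

end Linking

section Transfer

open CategoryTheory

variable {k G : Type u} [CommRing k] [Group G] [Finite G]

/-- For `f` in the coinduced module `Coind_H^G(A)`, the value `g⁻¹ f(g)`, which only depends on the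
coset `H g`. -/
def cosetTerm (H : Subgroup G) (A : Rep.{u} k G)
    (f : Representation.coindV H.subtype (Rep.res H.subtype A).ρ) :
    Quotient (QuotientGroup.rightRel H) → A.V :=
  Quotient.lift (fun g => A.ρ g⁻¹ (f.1 g)) fun a b hab => by
    rw [← Quotient.eq_iff_equiv, Quotient.eq, QuotientGroup.rightRel_apply] at hab
    have h : f.1 b = A.ρ (b * a⁻¹) (f.1 a) := by
      have := f.2 ⟨b * a⁻¹, hab⟩ a
      simpa using this
    dsimp only
    rw [h, ← Module.End.mul_apply, ← map_mul]
    simp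

/-- For a subgroup `H` of `G`, the map from the coinduced module `Coind_H^G(A)` to `A` that sends
`f` to the sum of `g⁻¹ f(g)` over the cosets `H g`. -/
def coindToSelf (H : Subgroup G) (A : Rep.{u} k G) :
    Rep.coind H.subtype (Rep.res H.subtype A) ⟶ A :=
  Rep.ofHom (ρ := Representation.coind H.subtype (Rep.res H.subtype A).ρ) (σ := A.ρ)
    (LinearMap.intertwiningMap_of_isIntertwiningMap _ _
      { toFun f := ∑ᶠ q, cosetTerm H A f q
        map_add' := fun f f' => by
          rw [← finsum_add_distrib (Set.toFinite _) (Set.toFinite _)]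
          refine finsum_congr fun q => ?_
          induction q using Quotient.inductionOn with | h g => simp [cosetTerm]
        map_smul' := fun c f => by
          rw [RingHom.id_apply, smul_finsum' c (Set.toFinite _)]
          refine finsum_congr fun q => ?_
          induction q using Quotient.inductionOn with | h g => simp [cosetTerm] }
      fun g f => by
        let e : Quotient (QuotientGroup.rightRel H) ≃ Quotient (QuotientGroup.rightRel H) :=
          Quotient.congr (Equiv.mulRight g) fun a b => by
            rw [QuotientGroup.rightRel_apply, QuotientGroup.rightRel_apply]
            simp
        change ∑ᶠ q, cosetTerm H A (Representation.coind H.subtype (Rep.res H.subtype A).ρ g f) q =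
          A.ρ g (∑ᶠ q, cosetTerm H A f q)
        rw [← finsum_comp_equiv e (f := cosetTerm H A f)]
        refine Eq.trans (finsum_congr fun q => ?_)
          (AddMonoidHom.map_finsum (A.ρ g).toAddMonoidHom (Set.toFinite _)).symm
        induction q using Quotient.inductionOn with | h x =>
        change A.ρ x⁻¹ (f.1 (x * g)) = A.ρ g (A.ρ (x * g)⁻¹ (f.1 (x * g)))
        rw [← Module.End.mul_apply, ← map_mul]
        simp)

/-- The transfer `Hⁿ(H, A) → Hⁿ(G, A)`: the inverse of the isomorphism of Shapiro's lemma,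
`Hⁿ(H, A) ≅ Hⁿ(G, Coind_H^G(A))`, followed by the map induced by `Coind_H^G(A) → A`. -/
def transfer (H : Subgroup G) (A : Rep.{u} k G) (n : ℕ) :
    groupCohomology (Rep.res H.subtype A) n ⟶ groupCohomology A n :=
  (groupCohomology.coindIso (Rep.res H.subtype A) n).inv ≫
    groupCohomology.map (MonoidHom.id G) (coindToSelf H A) n

/-- The restriction `Hⁿ(G, A) → Hⁿ(H, A)`. -/
def restriction (H : Subgroup G) (A : Rep.{u} k G) (n : ℕ) :
    groupCohomology A n ⟶ groupCohomology (Rep.res H.subtype A) n :=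
  groupCohomology.map H.subtype (𝟙 _) n

end Transfer

section Biset

variable {S : Type u} [Group S]

/-- An `(S, S)`-biset is given as a set with an action of `S × S`, where `(s, t)` acts by
`x ↦ s x t⁻¹`. For a subgroup `P` of `S` and `φ : P → S`, the transitive biset `[P, φ]` is
`(S × S) / Δ(P, φ)` with `Δ(P, φ)` the subgroup of all `(u, φ(u))`. -/
def graphSubgroup (P : Subgroup S) {Q : Subgroup S} (φ : P →* Q) : Subgroup (S × S) :=
  (P.subtype.prod (Q.subtype.comp φ)).range

namespace FusionSystem

variable (F : FusionSystem S) (Ω : Type v) [MulAction (S × S) Ω]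

/-- The left action is free. -/
def IsLeftFree (_F : FusionSystem S) (Ω : Type v) [MulAction (S × S) Ω] : Prop :=
  ∀ (s : S) (x : Ω), (s, (1 : S)) • x = x → s = 1

/-- `Ω` is a union of bisets `[P, φ]` with `P ≤ S` and `φ : P → S` in the fusion system (a
transitive biset is isomorphic to `[P, φ]` iff `Δ(P, φ)` is a stabilizer of one of its points, and
the class of these subgroups is closed under conjugation). -/
def IsGenerated : Prop :=
  ∀ x : Ω, ∃ (P : Subgroup S), ∃ φ ∈ F.Hom P ⊤,
    MulAction.stabilizer (S × S) x = graphSubgroup P φ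

/-- `Ω` is a union of bisets `[P, φ]` as above with `P` centric. -/
def IsCentricGenerated : Prop :=
  ∀ x : Ω, ∃ (P : F.Centric), ∃ φ ∈ F.Hom P.toSubgroup ⊤,
    MulAction.stabilizer (S × S) x = graphSubgroup P.toSubgroup φ

/-- For all `φ : P → S` in the fusion system, restricting the left action along `φ` and along the
inclusion of `P` gives isomorphic `(P, S)`-bisets. -/
def IsLeftStable : Prop :=
  ∀ (P : Subgroup S), ∀ φ ∈ F.Hom P ⊤, ∃ e : Ω ≃ Ω, ∀ (u : P) (s : S) (x : Ω),
    e (((u : S), s) • x) = ((φ u : S), s) • e x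

/-- For all `φ : P → S` in the fusion system, restricting the right action along `φ` and along the
inclusion of `P` gives isomorphic `(S, P)`-bisets. -/
def IsRightStable : Prop :=
  ∀ (P : Subgroup S), ∀ φ ∈ F.Hom P ⊤, ∃ e : Ω ≃ Ω, ∀ (s : S) (u : P) (x : Ω),
    e ((s, (u : S)) • x) = (s, (φ u : S)) • e x

/-- `Ω` is a characteristic biset. -/
structure IsCharacteristic (p : ℕ) : Prop where
  finite : Finite Ω
  leftFree : F.IsLeftFree Ω
  generated : F.IsGenerated Ω
  leftStable : F.IsLeftStable Ω
  rightStable : F.IsRightStable Ω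
  nondegenerate : ¬ p ∣ Nat.card Ω / Nat.card S

/-- `Ω` is a minimal characteristic biset: it is characteristic and no proper sub-biset is. -/
structure IsMinimalCharacteristic (p : ℕ) : Prop where
  isCharacteristic : F.IsCharacteristic Ω p
  eq_top : ∀ T : SubMulAction (S × S) Ω, F.IsCharacteristic T p → T = ⊤

end FusionSystem

end Biset

section Cohomology

open CategoryTheory

variable {S : Type u} [Group S] [Finite S] {F : FusionSystem S} [Category.{u} F.Centric]
  {k : Type u} [CommRing k]

namespace LinkingSystem

variable (L : LinkingSystem F) (M : Rep.{u} k L.Pi) (n : ℕ)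

/-- A `k[π_L]`-module as a `k[S]`-module. -/
abbrev resS : Rep.{u} k S := Rep.res L.fromS M

/-- For a morphism `ψ : P ⟶ S` of `L`, the map `x ↦ ω(ψ)⁻¹ x` from `M` to `M` is a morphism of
`k[P]`-modules from `M`, on which `P` acts through `π(ψ)`, to `M`. -/
def coeffMap {P : F.Centric} (ψ : P ⟶ F.centricTop) :
    Rep.res ((⊤ : Subgroup S).subtype.comp (L.π ψ)) (L.resS M) ⟶
      Rep.res P.toSubgroup.subtype (L.resS M) :=
  Rep.ofHom (LinearMap.intertwiningMap_of_isIntertwiningMap _ _ (M.ρ (L.ω ψ)⁻¹) fun g v => by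
    change M.ρ (L.ω ψ)⁻¹ (M.ρ (L.fromS (L.π ψ g : S)) v) =
      M.ρ (L.fromS (g : S)) (M.ρ (L.ω ψ)⁻¹ v)
    rw [← Module.End.mul_apply, ← Module.End.mul_apply, ← map_mul, ← map_mul]
    congr 2
    rw [inv_mul_eq_iff_eq_mul, ← mul_assoc, ← L.fromS_mul_ω, mul_inv_cancel_right])

/-- `ψ^* = H^n(π(ψ), ω(ψ)⁻¹) : H^n(S, M) → H^n(P, M)` for a morphism `ψ : P ⟶ S` of `L`. -/
def pullback {P : F.Centric} (ψ : P ⟶ F.centricTop) :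
    groupCohomology (L.resS M) n ⟶ groupCohomology (Rep.res P.toSubgroup.subtype (L.resS M)) n :=
  groupCohomology.map ((⊤ : Subgroup S).subtype.comp (L.π ψ)) (L.coeffMap M ψ) n

/-- `φ^* : H^n(S, M) → H^n(P, M)` for a morphism `φ : P → S` of the fusion system with `P` centric:
`φ^* = ψ^*` for a morphism `ψ` of `L` with `π(ψ) = φ` (it does not depend on `ψ`). -/
def fusionPullback {P : F.Centric} (φ : P.toSubgroup →* (⊤ : Subgroup S))
    (hφ : φ ∈ F.Hom P.toSubgroup ⊤) :
    groupCohomology (L.resS M) n ⟶ groupCohomology (Rep.res P.toSubgroup.subtype (L.resS M)) n :=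
  L.pullback M n (L.surjective (Q := F.centricTop) P.isFullyCentralized φ hφ).choose

/-- `H^n(F^c, M)`, the submodule of all `F^c`-stable elements of `H^n(S, M)`: the elements `x` with
`φ^*(x) = Res(x)` for all centric `P` and all `φ : P → S` in the fusion system. -/
def stable : Submodule k (groupCohomology (L.resS M) n) :=
  ⨅ (P : F.Centric) (φ : P.toSubgroup →* (⊤ : Subgroup S)) (hφ : φ ∈ F.Hom P.toSubgroup ⊤),
    LinearMap.eqLocus (L.fusionPullback M n φ hφ).hom
      (restriction P.toSubgroup (L.resS M) n).hom

/-- `Ω_* : H^n(S, M) → H^n(S, M)` for a biset `Ω` that is a union of bisets `[P, φ]` with `P`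
centric: the sum over its transitive components `[P, φ]` of `tr ∘ φ^*`. -/
def bisetMap {Ω : Type v} [MulAction (S × S) Ω] (hΩ : F.IsCentricGenerated Ω) :
    Module.End k (groupCohomology (L.resS M) n) :=
  ∑ᶠ o : MulAction.orbitRel.Quotient (S × S) Ω,
    (transfer (hΩ o.out).choose.toSubgroup (L.resS M) n).hom ∘ₗ
      (L.fusionPullback M n (hΩ o.out).choose_spec.choose
        (hΩ o.out).choose_spec.choose_spec.1).hom

end LinkingSystem

end Cohomology

/-- The ideal of `ℤ` generated by a prime number is prime. -/
instance isPrime_span_natCast (p : ℕ) [hp : Fact p.Prime] : (Ideal.span {(p : ℤ)}).IsPrime :=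
  (Ideal.span_singleton_prime (by exact_mod_cast hp.out.ne_zero)).mpr
    (Nat.prime_iff_prime_int.mp hp.out)

end PLocal

end

/-! Let `Q` be the largest normal subgroup of `F`, which is centric, and let `G` be the automorphism
group of `Q` in the linking system. The group `G` models the fusion: `S` embeds in `G` through
`toAut`, `ωAut` extends the action of `S` on `M` to `G`, and every morphism `ψ : P ⟶ S` of `L`
extends to `PQ` and then restricts to an element `g` of `G` that has the same `ω` and induces `π(ψ)`
by conjugation (`exists_aut`). Inner automorphisms act trivially on cohomology (`map_conj_eq_id`),
so classes restricted from `G` to `S` are stable.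

In a minimal characteristic biset all components `[P, φ]` satisfy `Q ≤ P`, because the union of
these components is itself characteristic (`isCharacteristic_normalPart`). Hence each `P` is
centric.

The main point is that `Ω_*` takes values in the image of `Hⁿ(G, M)`. By Shapiro's lemma a class of
`S` comes from a class of `G` with coinduced coefficients. Each `tr ∘ φ^*` is then induced by an
`S`-linear map from the coinduced module to `M`, a sum of `h⁻¹ f(h)` over certain cosets `j(S)h`
(`transfer_map_eq`). The sum over all components is `G`-linear if the resulting family of cosets is
invariant under right translation by `G` (`exists_sum_transfer_eq_map`). This family is indexed by
the right orbits of `Ω`, and left stability of `Ω` under the automorphisms of `Q` gives the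
invariance (`sum_finsum_eq_of_conjSet`).

On stable classes `φ^*` is restriction, so `Ω_*` is multiplication by the sum of the indices of the
`P`, which is `|Ω|/|S|`, a unit of `ℤ_(p)`. Dividing by it gives the idempotent. -/

noncomputable section

namespace PLocal

section

open CategoryTheory

/-! ### Comparison of projective resolutions in the computation of Ext. -/

section ExtNaturality

variable {R : Type*} [Ring R] {C : Type*} [Category* C] [Abelian C] [Linear R C]

/-- The map of complexes `Hom(L, Y) ⟶ Hom(K, Y)` induced by a chain map `K ⟶ L`. -/
def linearYonedaMap {K L : ChainComplex C ℕ} (φ : K ⟶ L) (Y : C) :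
    L.linearYonedaObj R Y ⟶ K.linearYonedaObj R Y :=
  (HomologicalComplex.unopFunctor _ _).map
    ((((linearYoneda R C).obj Y).rightOp.mapHomologicalComplex _).map φ).op

/-- Ext is a left derived functor with values in the opposite category, and its identification with
homology is natural in lifts of a map between resolved objects. Applied to a lift of the identity,
this leaves only the canonical comparison. -/
lemma homologyMap_linearYonedaMap [EnoughProjectives C] {X : C} {P Q : ProjectiveResolution X}
    (φ : P.complex ⟶ Q.complex) (h : φ.f 0 ≫ Q.π.f 0 = P.π.f 0) (Y : C) (n : ℕ) :
    HomologicalComplex.homologyMap (linearYonedaMap (R := R) φ Y) n =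
      (Q.isoExt n Y).inv ≫ (P.isoExt n Y).hom := by
  have h1 := P.isoLeftDerivedObj_inv_naturality (𝟙 X) Q φ (h.trans (Category.comp_id _).symm)
    ((linearYoneda R C).obj Y).rightOp n
  rw [CategoryTheory.Functor.map_id, Category.comp_id] at h1
  have h2 := HomologicalComplex.homologyOp_hom_naturality (i := n) (linearYonedaMap (R := R) φ Y)
  have h3 : (HomologicalComplex.homologyMap (linearYonedaMap (R := R) φ Y) n).op ≫
      (HomologicalComplex.homologyOp (Q.complex.linearYonedaObj R Y) n).inv =
      (HomologicalComplex.homologyOp (P.complex.linearYonedaObj R Y) n).inv ≫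
      HomologicalComplex.homologyMap ((HomologicalComplex.opFunctor _ _).map
        (linearYonedaMap (R := R) φ Y).op) n := by
    exact (Iso.eq_inv_comp _).2 ((Category.assoc _ _ _).symm.trans ((Iso.comp_inv_eq _).2 h2.symm))
  rw [Iso.eq_inv_comp]
  apply Quiver.Hom.op_inj
  have h4 := congrArg (· ≫ (Q.isoLeftDerivedObj ((linearYoneda R C).obj Y).rightOp n).inv) h3
  have h5 := (Category.assoc _ _ _).symm.trans (h4.trans (Category.assoc _ _ _))
  exact h5.trans (congrArg _ h1.symm)

lemma isoOfQuasiIsoAt_ofIso_inv {D : Type*} [Category* D] [Preadditive D] [CategoryWithHomology D]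
    {ι : Type*} {c : ComplexShape ι} {K L : HomologicalComplex D c} (e : K ≅ L) (i : ι) :
    (isoOfQuasiIsoAt (HomotopyEquiv.ofIso e).hom i).inv = HomologicalComplex.homologyMap e.inv i := by
  rw [← cancel_epi (isoOfQuasiIsoAt (HomotopyEquiv.ofIso e).hom i).hom, Iso.hom_inv_id,
    isoOfQuasiIsoAt_hom, show (HomotopyEquiv.ofIso e).hom = e.hom from rfl, ← HomologicalComplex.homologyMap_comp,
    e.hom_inv_id, HomologicalComplex.homologyMap_id]

end ExtNaturality

/-! ### Bar resolution, change of groups, and the Shapiro isomorphism. -/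

section Bar
open Rep Finsupp TensorProduct
variable {k G H : Type u} [CommRing k] [Group G] [Group H]

/-- The components of the map of bar complexes induced by a group homomorphism. -/
def barMapX (k : Type u) [CommRing k] (f : H →* G) (n : ℕ) :
    free k H (Fin n → H) ⟶ res f (free k G (Fin n → G)) :=
  freeLift k H (res f (free k G (Fin n → G))) fun x => single (f ∘ x) (.single 1 1)

lemma barMapX_single (f : H →* G) (n : ℕ) (x : Fin n → H) (h : H) (r : k) :
    (barMapX k f n).hom (single x (.single h r)) = single (f ∘ x) (.single (f h) r) := by
  rw [barMapX]
  simp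

lemma barMapX_comm (f : H →* G) (n : ℕ) :
    barMapX k f (n + 1) ≫ resMap f (barComplex.d k G n) = barComplex.d k H n ≫ barMapX k f n := by
  refine free_ext k H _ _ _ fun x => ?_
  rw [Rep.hom_comp, Rep.hom_comp, Representation.IntertwiningMap.comp_apply,
    Representation.IntertwiningMap.comp_apply, barMapX_single, barComplex.d_single, map_add,
    map_sum, barMapX_single, map_one]
  refine (barComplex.d_single (k := k) (n := n) (f ∘ x)).trans ?_
  refine congrArg₂ (· + ·) rfl (Finset.sum_congr rfl fun j _ => ?_)
  refine Eq.trans ?_ (barMapX_single f n _ _ _).symm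
  rw [map_one, Fin.comp_contractNth (f := f) (· * ·) (· * ·) (map_mul f)]

/-- The map of bar complexes induced by a group homomorphism. -/
def barMap (k : Type u) [CommRing k] (f : H →* G) :
    barComplex k H ⟶ ((resFunctor f).mapHomologicalComplex _).obj (barComplex k G) where
  f n := barMapX k f n
  comm' i j hij := by
    obtain rfl : j + 1 = i := hij
    exact (congrArg (fun d => barMapX k f (j + 1) ≫ resMap f d) (barComplex.d_def k G)).trans
      ((barMapX_comm f j).trans (congrArg (· ≫ barMapX k f j) (barComplex.d_def k H).symm))

/-- The augmentation of the bar resolution. -/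
def barAugmentation (k G : Type u) [CommRing k] [Group G] :
    free k G (Fin 0 → G) ⟶ Rep.trivial k G k :=
  freeLift k G (Rep.trivial k G k) fun _ => (1 : k)

lemma barAugmentation_single (x : Fin 0 → G) :
    (barAugmentation k G).hom (single x (.single 1 1)) = (1 : k) := by
  rw [barAugmentation]
  simp [Rep.trivial]

/-- Which basis element `y` occurs is irrelevant: the augmentation sends all of them to `1`. -/
lemma exists_diagonalSuccIsoFree_inv_single (n : ℕ) (x : Fin n → G) (g : G) (r : k) :
    ∃ y, (diagonalSuccIsoFree k G n).inv.hom (single x (.single g r)) =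
      MonoidAlgebra.single y r := by
      simp only [diagonalSuccIsoFree, diagonalSuccIsoTensorTrivial, Iso.trans_inv, Rep.hom_comp,
        Representation.IntertwiningMap.comp_apply]
      have step1 : (Hom.hom (leftRegularTensorTrivialIsoFree k G (Fin n → G)).inv)
          (single x (.single g r)) = .single g 1 ⊗ₜ[k] .single x r :=
        Representation.leftRegularTensorTrivialIsoFree_symm_apply_single_single x g r
      rw [step1]
      have key₁ := Representation.linearizeMap_single (k := k)
        (Action.diagonalSuccIsoTensorTrivial G n).inv (g, x) ((1 : k) * r)
      have key₂ := Representation.LinearizeMonoidal.μ_apply_single_single (k := k)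
        (X := Action.leftRegular G) (Y := Action.trivial G (Fin n → G)) g x 1 r
      have h := ((congrArg (fun z => (Representation.linearizeMap
        (Action.diagonalSuccIsoTensorTrivial G n).inv) z) key₂).trans key₁)
      rw [one_mul] at h
      exact ⟨_, h⟩

lemma barResolution_π_f_zero : (barResolution k G).π.f 0 = barAugmentation k G := by
  have h : (barResolution k G).π.f 0 = (diagonalSuccIsoFree k G 0).inv ≫ standardComplex.ε k G :=
    congrArg ((diagonalSuccIsoFree k G 0).inv ≫ ·) (ChainComplex.toSingle₀Equiv_symm_apply_f_zero _ _)
  refine h.trans (free_ext k G _ _ _ fun x => ?_)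
  rw [Rep.hom_comp, Representation.IntertwiningMap.comp_apply, barAugmentation_single]
  obtain ⟨y, hy⟩ := exists_diagonalSuccIsoFree_inv_single (k := k) 0 x 1 1
  rw [hy]
  simp [standardComplex.ε]

lemma barMapX_zero_comp_barAugmentation (f : H →* G) :
    barMapX k f 0 ≫ resMap f (barAugmentation k G) = barAugmentation k H := by
  refine free_ext k H _ _ _ fun x => ?_
  rw [Rep.hom_comp, Representation.IntertwiningMap.comp_apply, barMapX_single,
    map_one]
  exact (barAugmentation_single (f ∘ x)).trans (barAugmentation_single x).symm

lemma freeLift_hom_single (A : Rep.{u} k G) (n : ℕ) (x : (Fin n → G) → A) (y : Fin n → G) :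
    (freeLift k G A x).hom (single y (.single 1 1)) = x y := by
  simp

/-- The isomorphism from inhomogeneous cochains to `Hom` out of the bar complex is natural. -/
lemma freeLift_comp {A : Rep.{u} k G} {B : Rep.{u} k H} (f : H →* G) (φ : res f A ⟶ B) (n : ℕ)
    (x : (Fin n → G) → A) :
    barMapX k f n ≫ resMap f (freeLift k G A x) ≫ φ =
      freeLift k H B (fun y => φ.hom (x (f ∘ y))) := by
  refine free_ext k H _ _ _ fun y => ?_
  rw [Rep.hom_comp, Representation.IntertwiningMap.comp_apply, barMapX_single, map_one,
    Rep.hom_comp, Representation.IntertwiningMap.comp_apply, freeLift_hom_single]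
  exact congrArg φ.hom (freeLift_hom_single A n x (f ∘ y))

/-- The Shapiro isomorphism computes Ext over `K` from the restricted bar resolution of `G`. The map
of bar complexes induced by `K ≤ G` lifts the identity of the trivial module, so it realizes the
comparison with the bar resolution of `K`; on cochains it is restriction followed by evaluation at
`1`. -/
lemma coindIso_hom_eq (K : Subgroup G) (A : Rep.{u} k K) (n : ℕ) :
    (groupCohomology.coindIso A n).hom = groupCohomology.map K.subtype
      ((resCoindHomEquiv.{u} K.subtype (coind K.subtype A) A).symm (𝟙 _)) n := by
  set ε := (resCoindHomEquiv.{u} K.subtype (coind K.subtype A) A).symm (𝟙 _) with hε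
  let P : ProjectiveResolution (Rep.trivial k K k) :=
    (resFunctor K.subtype).mapProjectiveResolution (barResolution k G)
  let β : (barResolution k K).complex ⟶ P.complex := barMap k K.subtype
  have hβ : β.f 0 ≫ P.π.f 0 = (barResolution k K).π.f 0 := by
    rw [barResolution_π_f_zero]
    rw [← barMapX_zero_comp_barAugmentation K.subtype]
    have h4 : P.π.f 0 = resMap K.subtype ((barResolution k G).π.f 0) := by
      exact Category.comp_id (resMap K.subtype ((barResolution k G).π.f 0))
    rw [h4, barResolution_π_f_zero]
    rfl
  let e : groupCohomology.inhomogeneousCochains A ≅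
      (barResolution k K).complex.linearYonedaObj k A :=
    groupCohomology.inhomogeneousCochainsIso A
  obtain ⟨u, hu⟩ : ∃ u : groupCohomology.inhomogeneousCochains (coind K.subtype A) ⟶
      P.complex.linearYonedaObj k A,
      u = (groupCohomology.inhomogeneousCochainsIso (coind K.subtype A)).hom ≫
        (groupCohomology.linearYonedaObjResProjectiveResolutionIso (barResolution k G) A).inv :=
    ⟨_, rfl⟩
  have h1 : groupCohomology.cochainsMap K.subtype ε ≫ e.hom = u ≫ linearYonedaMap β A := by
    rw [hu]
    refine HomologicalComplex.hom_ext _ _ fun n => ModuleCat.hom_ext (LinearMap.ext fun x => ?_)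
    exact (freeLift_comp K.subtype ε n x).symm
  have h2 : (groupCohomology.coindIso A n).hom = HomologicalComplex.homologyMap u n ≫
      ((P.isoExt n A).inv ≫ ((barResolution k K).isoExt n A).hom) ≫
        HomologicalComplex.homologyMap e.inv n := by
    rw [hu]
    have h3 := isoOfQuasiIsoAt_ofIso_inv e n
    rw [← h3]
    rfl
  rw [h2, ← homologyMap_linearYonedaMap β hβ, ← HomologicalComplex.homologyMap_comp,
    ← HomologicalComplex.homologyMap_comp, ← Category.assoc, ← h1, Category.assoc, e.hom_inv_id,
    Category.comp_id]

end Bar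

end

section

open CategoryTheory

/-! ### Functoriality of group cohomology and triviality of inner automorphisms. -/

section Functoriality
open Rep
variable {k G H K : Type u} [CommRing k] [Group G] [Group H] [Group K]

/-- The composite homomorphism `h` and its coefficient map are independent variables, so that
homomorphisms equal only propositionally can be exchanged and coefficient maps need only agree on
values. -/
lemma map_comp_eq {A : Rep.{u} k K} {B : Rep.{u} k H} {C : Rep.{u} k G} {f : H →* K} {g : G →* H}
    {h : G →* K} (φ : res f A ⟶ B) (ψ : res g B ⟶ C) (χ : res h A ⟶ C) (hfg : f.comp g = h)
    (hχ : ∀ v : A.V, ψ.hom (φ.hom v) = χ.hom v) (n : ℕ) :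
    groupCohomology.map f φ n ≫ groupCohomology.map g ψ n = groupCohomology.map h χ n := by
  rw [← groupCohomology.map_comp]
  exact groupCohomology.map_congr hfg (LinearMap.ext hχ) n

lemma map_map_apply {A : Rep.{u} k K} {B : Rep.{u} k H} {C : Rep.{u} k G} {f : H →* K}
    {g : G →* H} {h : G →* K} (φ : res f A ⟶ B) (ψ : res g B ⟶ C) (χ : res h A ⟶ C)
    (hfg : f.comp g = h) (hχ : ∀ v : A.V, ψ.hom (φ.hom v) = χ.hom v) (n : ℕ)
    (x : groupCohomology A n) :
    (groupCohomology.map g ψ n).hom ((groupCohomology.map f φ n).hom x) =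
      (groupCohomology.map h χ n).hom x :=
  congrArg (fun m => ModuleCat.Hom.hom m x) (map_comp_eq φ ψ χ hfg hχ n)

lemma cochainsMap_add {A : Rep.{u} k H} {B : Rep.{u} k G} (f : G →* H) (φ ψ : res f A ⟶ B) :
    groupCohomology.cochainsMap f (φ + ψ) =
      groupCohomology.cochainsMap f φ + groupCohomology.cochainsMap f ψ := rfl

lemma map_sum_apply {A : Rep.{u} k H} {B : Rep.{u} k G} (f : G →* H) {ι : Type*} (s : Finset ι)
    (φ : ι → (res f A ⟶ B)) (n : ℕ) (x : groupCohomology A n) :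
    (groupCohomology.map f (∑ i ∈ s, φ i) n).hom x =
      ∑ i ∈ s, (groupCohomology.map f (φ i) n).hom x := by
  have h : groupCohomology.map f (∑ i ∈ s, φ i) n = ∑ i ∈ s, groupCohomology.map f (φ i) n :=
    map_sum (AddMonoidHom.mk' (fun φ : res f A ⟶ B => groupCohomology.map f φ n) fun φ ψ =>
      (congrArg (HomologicalComplex.homologyMap · n) (cochainsMap_add f φ ψ)).trans
        (HomologicalComplex.homologyMap_add (φ := groupCohomology.cochainsMap f φ)
          (ψ := groupCohomology.cochainsMap f ψ) (i := n))) φ s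
  rw [h, ModuleCat.hom_sum, LinearMap.sum_apply]

/-- Translation by `g⁻¹`, as a morphism from a representation twisted by conjugation with `g`. -/
def conjHom (A : Rep.{u} k G) (g : G) : res (MulAut.conj g).toMonoidHom A ⟶ A :=
  Rep.ofHom ⟨A.ρ g⁻¹, fun h => by
    ext v
    simp [← Module.End.mul_apply, ← map_mul, mul_assoc]⟩

lemma conjHom_naturality {A B : Rep.{u} k G} (f : A ⟶ B) (g : G) :
    resMap (MulAut.conj g).toMonoidHom f ≫ conjHom B g = conjHom A g ≫ f := by
  refine Rep.hom_ext (Representation.IntertwiningMap.ext (LinearMap.ext fun v => ?_))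
  exact (hom_comm_apply f g⁻¹ v).symm

/-- The endomorphism of the bar complex given by conjugation with `g` followed by translation by
`g⁻¹`. -/
def barConj (k : Type u) [CommRing k] (g : G) :
    (barResolution k G).complex ⟶ (barResolution k G).complex where
  f n := barMapX k (MulAut.conj g).toMonoidHom n ≫ conjHom _ g
  comm' i j hij := by
    obtain rfl : j + 1 = i := hij
    have h : (barMapX k (MulAut.conj g).toMonoidHom (j + 1) ≫ conjHom _ g) ≫ barComplex.d k G j =
        barComplex.d k G j ≫ barMapX k (MulAut.conj g).toMonoidHom j ≫ conjHom _ g := by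
      rw [Category.assoc, ← conjHom_naturality, ← Category.assoc, barMapX_comm, Category.assoc]
    rw [show (barResolution k G).complex.d (j + 1) j = barComplex.d k G j from barComplex.d_def k G]
    exact h

/-- Inner automorphisms act trivially on group cohomology. -/
lemma map_conj_eq_id (A : Rep.{u} k G) (g : G) (n : ℕ) :
    groupCohomology.map (MulAut.conj g).toMonoidHom (conjHom A g) n = 𝟙 _ := by
  -- Translation is trivial on the trivial module, so `barConj` lifts its identity and must induce
  -- the identity on Ext.
  have hβ : (barConj k g).f 0 ≫ (barResolution k G).π.f 0 = (barResolution k G).π.f 0 := by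
    rw [barResolution_π_f_zero]
    refine (Category.assoc _ _ _).trans ?_
    refine (congrArg (_ ≫ ·) (conjHom_naturality (barAugmentation k G) g).symm).trans ?_
    refine (Category.assoc _ _ _).symm.trans ?_
    refine (congrArg (· ≫ _) (barMapX_zero_comp_barAugmentation _)).trans ?_
    refine Rep.hom_ext (Representation.IntertwiningMap.ext (LinearMap.ext fun v => ?_))
    rfl
  let e : groupCohomology.inhomogeneousCochains A ≅
      (barResolution k G).complex.linearYonedaObj k A :=
    groupCohomology.inhomogeneousCochainsIso A
  have h1 : groupCohomology.cochainsMap (MulAut.conj g).toMonoidHom (conjHom A g) ≫ e.hom =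
      e.hom ≫ linearYonedaMap (barConj k g) A := by
    refine HomologicalComplex.hom_ext _ _ fun n => ModuleCat.hom_ext (LinearMap.ext fun x => ?_)
    refine (freeLift_comp (MulAut.conj g).toMonoidHom (conjHom A g) n x).symm.trans ?_
    refine (congrArg (_ ≫ ·) (conjHom_naturality (freeLift k G A x) g)).trans ?_
    exact (Category.assoc _ _ _).symm
  have h2 := congrArg (HomologicalComplex.homologyMap · n) h1
  rw [HomologicalComplex.homologyMap_comp, HomologicalComplex.homologyMap_comp,
    homologyMap_linearYonedaMap (P := barResolution k G) (Q := barResolution k G) _ hβ,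
    Iso.inv_hom_id, Category.comp_id] at h2
  have : IsIso (HomologicalComplex.homologyMap e.hom n) := inferInstance
  exact (cancel_mono (HomologicalComplex.homologyMap e.hom n)).1 (h2.trans (Category.id_comp _).symm)

end Functoriality

/-! ### Shapiro's lemma along an injective homomorphism. -/

section Coind
open Rep
variable {k G S : Type u} [CommRing k] [Group G] [Group S]

/-- Evaluation at `1` on a coinduced representation. -/
def coindEval (j : S →* G) (A : Rep.{u} k S) : res j (coind j A) ⟶ A :=
  (resCoindHomEquiv.{u} j (coind j A) A).symm (𝟙 _)

/-- This is Shapiro's lemma for the subgroup `j(S)`, transported along the isomorphism of `S` with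
`j(S)`. -/
lemma map_coindEval_surjective {j : S →* G} (hj : Function.Injective j) (A : Rep.{u} k S) (n : ℕ) :
    Function.Surjective (groupCohomology.map j (coindEval j A) n).hom := by
  let e : S ≃* j.range := MonoidHom.ofInjective hj
  let A' : Rep k j.range := res e.symm.toMonoidHom A
  let φ : res e.toMonoidHom A' ⟶ A := Rep.ofHom ⟨LinearMap.id, fun s => by
    ext v
    simp [A']⟩
  let κ : coind j.range.subtype A' ⟶ coind j A := Rep.ofHom
    ⟨LinearMap.codRestrict _ (Submodule.subtype _) fun f s g => by
      have := f.2 (e s) g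
      simp [A'] at this
      exact this, fun g => by ext; rfl⟩
  -- Evaluation at `1` on coinduction from `j(S)`, regarded over `S`: both routes to `Hⁿ(S, A)`
  -- compared below are equal to the map it induces.
  let ε : res j (coind j.range.subtype A') ⟶ A := Rep.ofHom ⟨LinearMap.proj 1 ∘ₗ Submodule.subtype _,
    fun s => LinearMap.ext fun f => by
      have h1 : f.1 (j s * 1) = A.ρ (e.symm (e s)) (f.1 1) := f.2 (e s) 1
      rw [e.symm_apply_apply, mul_one, ← one_mul (j s)] at h1
      exact h1⟩
  let φ' : res e.symm.toMonoidHom A ⟶ A' := 𝟙 _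
  intro x
  obtain ⟨y, hy⟩ : ∃ y, (groupCohomology.coindIso A' n).hom.hom y =
      (groupCohomology.map e.symm.toMonoidHom φ' n).hom x :=
    ⟨(groupCohomology.coindIso A' n).inv.hom ((groupCohomology.map e.symm.toMonoidHom φ' n).hom x),
      congrArg (fun m => ModuleCat.Hom.hom m _) (groupCohomology.coindIso A' n).inv_hom_id⟩
  rw [coindIso_hom_eq] at hy
  refine ⟨(groupCohomology.map (MonoidHom.id G) κ n).hom y, ?_⟩
  have h1 := map_map_apply (f := MonoidHom.id G) κ (coindEval j A) ε rfl (fun v => rfl) n y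
  have h2 := map_map_apply (coindEval j.range.subtype A') φ ε (f := j.range.subtype)
    (g := e.toMonoidHom) rfl (fun v => rfl) n y
  have h3 := map_map_apply φ' φ (𝟙 A) (h := MonoidHom.id S) (f := e.symm.toMonoidHom)
    (g := e.toMonoidHom) (MonoidHom.ext e.symm_apply_apply) (fun v => rfl) n x
  refine h1.trans (h2.symm.trans ?_)
  refine (congrArg _ hy).trans (h3.trans ?_)
  rw [groupCohomology.map_id]
  rfl

end Coind
-- Transfer and restriction.
section Transfer
open Rep
variable {k G S : Type u} [CommRing k] [Group G] [Group S] [Finite S]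

lemma coindToSelf_hom_apply (P : Subgroup S) (A : Rep.{u} k S)
    (f : (Rep.coind P.subtype (Rep.res P.subtype A)).V) :
    (coindToSelf P A).hom f = ∑ᶠ q : Quotient (QuotientGroup.rightRel P),
      A.ρ q.out⁻¹ (f.1 q.out) := by
  change ∑ᶠ q, cosetTerm P A f q = _
  refine finsum_congr fun q => ?_
  conv_lhs => rw [← q.out_eq]
  rfl

/-- Transfer after a map that factors through the isomorphism of Shapiro's lemma. -/
lemma transfer_map_coindEval (P : Subgroup S) (A : Rep.{u} k S) (n : ℕ)
    (z : groupCohomology (coind P.subtype (res P.subtype A)) n) :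
    (transfer P A n).hom ((groupCohomology.map P.subtype (coindEval P.subtype _) n).hom z) =
      (groupCohomology.map (MonoidHom.id S) (coindToSelf P A) n).hom z := by
  have h := coindIso_hom_eq P (res P.subtype A) n
  change (groupCohomology.map (MonoidHom.id S) (coindToSelf P A) n).hom
    ((groupCohomology.coindIso _ n).inv.hom _) = _
  refine congrArg _ ?_
  change (groupCohomology.coindIso _ n).inv.hom ((groupCohomology.map P.subtype
    ((resCoindHomEquiv.{u} P.subtype (coind P.subtype _) _).symm (𝟙 _)) n).hom z) = _
  rw [← h]
  exact congrArg (fun m => ModuleCat.Hom.hom m z) (groupCohomology.coindIso _ n).hom_inv_id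

/-- Transfer after restriction is multiplication by the index. -/
lemma transfer_restriction (P : Subgroup S) (A : Rep.{u} k S) (n : ℕ) (x : groupCohomology A n) :
    (transfer P A n).hom ((restriction P A n).hom x) =
      Nat.card (Quotient (QuotientGroup.rightRel P)) • x := by
  -- The unit of the adjunction, `v ↦ (s ↦ s v)`. Followed by evaluation at `1` it is the identity,
  -- and followed by `coindToSelf` it is multiplication by the index.
  let η : A ⟶ coind P.subtype (res P.subtype A) := resCoindToHom P.subtype A _ (𝟙 _)
  have h1 := map_map_apply (f := MonoidHom.id S) η (coindEval P.subtype (res P.subtype A)) (𝟙 _)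
    (h := P.subtype) rfl (fun v => by
      change A.ρ 1 v = v
      rw [map_one]
      rfl) n x
  have h2 := map_map_apply (f := MonoidHom.id S) η (coindToSelf P A)
    (g := MonoidHom.id S) (h := MonoidHom.id S)
    -- Multiplication by the index is written as a sum of identities, so that additivity in the
    -- coefficient map applies.
    (∑ _q : Fin (Nat.card (Quotient (QuotientGroup.rightRel P))), 𝟙 A) rfl (fun v => by
      refine (coindToSelf_hom_apply P A (η.hom v)).trans ?_
      trans ∑ᶠ q : Quotient (QuotientGroup.rightRel P), v
      · refine finsum_congr fun q => ?_
        change A.ρ q.out⁻¹ (A.ρ q.out v) = v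
        rw [← Module.End.mul_apply, ← map_mul, inv_mul_cancel, map_one]
        rfl
      · have := Fintype.ofFinite (Quotient (QuotientGroup.rightRel P))
        rw [finsum_eq_sum_of_fintype, Rep.sum_hom, Representation.IntertwiningMap.sum_apply,
          Finset.sum_const, Finset.card_univ, ← Nat.card_eq_fintype_card]
        refine Eq.trans ?_ (Finset.sum_const v).symm
        rw [Finset.card_univ, Fintype.card_fin]) n x
  change (transfer P A n).hom ((groupCohomology.map P.subtype (𝟙 _) n).hom x) = _
  rw [← h1, transfer_map_coindEval, h2, map_sum_apply, groupCohomology.map_id, Finset.sum_const,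
    Finset.card_univ, Fintype.card_fin]
  rfl

end Transfer

/-! ### Transfers of classes pulled back along elements of an ambient group. -/

section Ambient
open Rep
variable {k G S : Type u} [CommRing k] [Group G] [Group S] {j : S →* G} {N : Rep.{u} k G}

/-- Translation by `g⁻¹` induces the identity on restrictions of classes of the ambient group. -/
lemma map_res_eq_restriction {P : Subgroup S} {φ : P →* S} {g : G}
    (hφ : ∀ u : P, j (φ u) = g * j u * g⁻¹) (c : res φ (res j N) ⟶ res P.subtype (res j N))
    (hc : ∀ v : N.V, c.hom v = N.ρ g⁻¹ v) (n : ℕ) (z : groupCohomology N n) :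
    (groupCohomology.map φ c n).hom ((groupCohomology.map j (𝟙 (res j N)) n).hom z) =
      (restriction P (res j N) n).hom ((groupCohomology.map j (𝟙 (res j N)) n).hom z) := by
  let χ : res (j.comp φ) N ⟶ res P.subtype (res j N) := c
  have h1 := map_map_apply (f := j) (𝟙 (res j N)) c χ rfl (fun _ => rfl) n z
  have h2 := map_map_apply (f := j) (𝟙 (res j N)) (g := P.subtype) (𝟙 _)
    (h := j.comp P.subtype) (𝟙 (res (j.comp P.subtype) N)) rfl (fun _ => rfl) n z
  -- The pair `(φ, c)` is conjugation by `g` on `G` followed by restriction to `P`, and conjugation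
  -- acts trivially.
  have h3 := map_map_apply (conjHom N g) (g := j.comp P.subtype) (𝟙 (res (j.comp P.subtype) N)) χ
    (MonoidHom.ext fun u => (hφ u).symm) (fun v => (hc v).symm) n z
  refine h1.trans (h3.symm.trans (Eq.trans ?_ h2.symm))
  rw [map_conj_eq_id]
  rfl

/-- The morphism between coinduced representations given by translation by `g`. -/
def coindTranslate (P : Subgroup S) (g : G) {φ : P →* S} (hφ : ∀ u : P, j (φ u) = g * j u * g⁻¹) :
    res j (coind j (res j N)) ⟶ coind P.subtype (res P.subtype (res j N)) :=
  resCoindToHom P.subtype (res j (coind j (res j N))) (res P.subtype (res j N))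
    (Rep.ofHom ⟨N.ρ g⁻¹ ∘ₗ LinearMap.proj g ∘ₗ Submodule.subtype _, fun u => LinearMap.ext fun f => by
      -- By Frobenius reciprocity it suffices that `f ↦ g⁻¹ f(g)` is `P`-linear; this follows from
      -- `g j(u) = j(φ u) g` and the equivariance of `f`.
      have h1 : f.1 (j (φ u) * g) = N.ρ (j (φ u)) (f.1 g) := f.2 (φ u) g
      change N.ρ g⁻¹ (f.1 (g * j u)) = N.ρ (j u) (N.ρ g⁻¹ (f.1 g))
      rw [show g * j u = j (φ u) * g by rw [hφ]; group, h1, ← Module.End.mul_apply,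
        ← Module.End.mul_apply, ← map_mul, ← map_mul, hφ]
      group⟩)

lemma coindTranslate_comp_coindToSelf_apply [Finite S] (P : Subgroup S) (g : G) {φ : P →* S}
    (hφ : ∀ u : P, j (φ u) = g * j u * g⁻¹) (f : (coind j (res j N)).V) :
    (coindTranslate (N := N) P g hφ ≫ coindToSelf P (res j N)).hom f =
      ∑ᶠ q : Quotient (QuotientGroup.rightRel P), N.ρ (g * j q.out)⁻¹ (f.1 (g * j q.out)) := by
  refine (coindToSelf_hom_apply P _ _).trans (finsum_congr fun q => ?_)
  change N.ρ (j q.out⁻¹) (N.ρ g⁻¹ (f.1 (g * j q.out))) = _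
  rw [← Module.End.mul_apply, ← map_mul, mul_inv_rev, map_inv]

/-- With coinduced coefficients, conjugation by `g` can be removed on the cohomology of `G`, which
turns evaluation at `1` into evaluation at `g`. What remains factors through Shapiro's isomorphism
for `P ≤ S`, where transfer becomes the coefficient map `coindToSelf`. -/
lemma transfer_map_eq [Finite S] {P : Subgroup S} {φ : P →* S} {g : G}
    (hφ : ∀ u : P, j (φ u) = g * j u * g⁻¹) (c : res φ (res j N) ⟶ res P.subtype (res j N))
    (hc : ∀ v : N.V, c.hom v = N.ρ g⁻¹ v) (n : ℕ) (y : groupCohomology (coind j (res j N)) n) :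
    (transfer P (res j N) n).hom ((groupCohomology.map φ c n).hom
      ((groupCohomology.map j (coindEval j (res j N)) n).hom y)) =
    (groupCohomology.map j (coindTranslate P g hφ ≫ coindToSelf P (res j N)) n).hom y := by
  let τ := coindTranslate (N := N) P g hφ
  let χ : res (j.comp P.subtype) (coind j (res j N)) ⟶ res P.subtype (res j N) :=
    (resFunctor P.subtype).map τ ≫ coindEval P.subtype _
  let χ' : res (j.comp φ) (coind j (res j N)) ⟶ res P.subtype (res j N) :=
    (resFunctor φ).map (coindEval j (res j N)) ≫ c
  have h1 := map_map_apply (f := j) (coindEval j (res j N)) c χ' rfl (fun _ => rfl) n y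
  have h2 := map_map_apply (f := j) τ (coindEval P.subtype _) χ rfl (fun _ => rfl) n y
  have h3 := map_map_apply (conjHom (coind j (res j N)) g) (g := j.comp P.subtype) χ χ'
    (MonoidHom.ext fun u => (hφ u).symm) (fun f => by
      refine Eq.trans ?_ (hc (f.1 1)).symm
      change N.ρ g⁻¹ (f.1 (g * j 1 * g⁻¹)) = _
      rw [map_one, mul_one, mul_inv_cancel]) n y
  have h4 := map_map_apply (f := j) τ (g := MonoidHom.id S) (coindToSelf P (res j N)) (τ ≫ coindToSelf P (res j N))
    rfl (fun _ => rfl) n y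
  rw [map_conj_eq_id] at h3
  rw [h1, ← h3]
  refine Eq.trans ?_ h4
  refine Eq.trans (congrArg (transfer P (res j N) n).hom h2.symm) ?_
  exact transfer_map_coindEval _ _ _ _

/-- A sum of composites of translations and transfers factors through the cohomology of the ambient
group if the corresponding family of cosets is invariant under translation. -/
lemma exists_sum_transfer_eq_map [Finite S] (hj : Function.Injective j) {ι : Type*} [Fintype ι]
    (P : ι → Subgroup S) (φ : ∀ i, P i →* S) (g : ι → G)
    (hφ : ∀ i (u : P i), j (φ i u) = g i * j u * (g i)⁻¹)
    (c : ∀ i, res (φ i) (res j N) ⟶ res (P i).subtype (res j N))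
    (hc : ∀ i (v : N.V), (c i).hom v = N.ρ (g i)⁻¹ v)
    (H : ∀ Φ : G → N.V, (∀ s h, Φ (j s * h) = Φ h) → ∀ h,
      ∑ i, ∑ᶠ q : Quotient (QuotientGroup.rightRel (P i)), Φ (g i * j q.out * h) =
        ∑ i, ∑ᶠ q : Quotient (QuotientGroup.rightRel (P i)), Φ (g i * j q.out))
    (n : ℕ) (x : groupCohomology (res j N) n) :
    ∃ z, ∑ i, (transfer (P i) (res j N) n).hom ((groupCohomology.map (φ i) (c i) n).hom x) =
      (groupCohomology.map j (𝟙 (res j N)) n).hom z := by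
  obtain ⟨y, rfl⟩ := map_coindEval_surjective hj (res j N) n x
  let θ := ∑ i, coindTranslate (N := N) (P i) (g i) (hφ i) ≫ coindToSelf (P i) (res j N)
  have hθ : ∀ f : (coind j (res j N)).V, θ.hom f = ∑ i, ∑ᶠ q : Quotient (QuotientGroup.rightRel (P i)),
      N.ρ (g i * j q.out)⁻¹ (f.1 (g i * j q.out)) := fun f => by
    rw [Rep.sum_hom, Representation.IntertwiningMap.sum_apply]
    exact Finset.sum_congr rfl fun i _ => coindTranslate_comp_coindToSelf_apply _ _ _ f
  -- The summand `h' ↦ h'⁻¹ f(h')` is constant on cosets `j(S)h'`, so `H` applies to it and upgrades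
  -- the `S`-linear map `θ` to a `G`-linear one.
  let θ' : coind j (res j N) ⟶ N := Rep.ofHom ⟨θ.hom.toLinearMap, fun h => LinearMap.ext fun f => by
    change θ.hom ((coind j (res j N)).ρ h f) = N.ρ h (θ.hom f)
    have h1 : ∀ s h', N.ρ (j s * h')⁻¹ (f.1 (j s * h')) = N.ρ h'⁻¹ (f.1 h') := fun s h' => by
      rw [show f.1 (j s * h') = N.ρ (j s) (f.1 h') from f.2 s h', ← Module.End.mul_apply, ← map_mul]
      group
    rw [hθ, hθ, ← H (fun h' => N.ρ h'⁻¹ (f.1 h')) h1 h, map_sum]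
    refine Finset.sum_congr rfl fun i _ => ?_
    refine Eq.trans (finsum_congr fun q => ?_)
      (AddMonoidHom.map_finsum (N.ρ h).toAddMonoidHom (Set.toFinite _)).symm
    change N.ρ (g i * j q.out)⁻¹ (f.1 (g i * j q.out * h)) =
      N.ρ h (N.ρ (g i * j q.out * h)⁻¹ (f.1 (g i * j q.out * h)))
    rw [← Module.End.mul_apply, ← map_mul]
    group⟩
  refine ⟨(groupCohomology.map (MonoidHom.id G) θ' n).hom y, ?_⟩
  have h2 := map_map_apply (f := MonoidHom.id G) θ' (𝟙 (res j N)) (h := j) θ rfl (fun _ => rfl) n y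
  rw [h2, map_sum_apply]
  exact Finset.sum_congr rfl fun i _ => transfer_map_eq (hφ i) (c i) (hc i) n y

end Ambient

end

/-! ### Normal subgroups of a fusion system. -/

section

namespace FusionSystem
variable {S : Type u} [Group S] (F : FusionSystem S)

lemma subtype_mem {P R : Subgroup S} (h : P ≤ R) : Subgroup.inclusion h ∈ F.Hom P R :=
  F.conj_mem _ 1 fun x => by simp

/-- Restriction of the target of a morphism. -/
lemma exists_codRestrict {P R R' : Subgroup S} {φ : P →* R} (hφ : φ ∈ F.Hom P R)
    (h : ∀ x : P, (φ x : S) ∈ R') : ∃ φ' ∈ F.Hom P R', ∀ x, (φ' x : S) = φ x := by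
  obtain ⟨T, hT, e, he, -, rfl⟩ := F.factor hφ
  have hTR : T ≤ R' := fun t ht => by
    have := h (e.symm ⟨t, ht⟩)
    simpa using this
  exact ⟨(Subgroup.inclusion hTR).comp e.toMonoidHom, F.comp_mem he (F.subtype_mem hTR), fun x => rfl⟩

variable {F} {Q : Subgroup S}

lemma IsNormal.normal (hQ : F.IsNormal Q) : Q.Normal := hQ.1

/-- A morphism extends over a normal subgroup, which it maps to itself. -/
lemma IsNormal.exists_extension (hQ : F.IsNormal Q) {P R : Subgroup S} {φ : P →* R} (hφ : φ ∈ F.Hom P R) :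
    ∃ ψ ∈ F.Hom (P ⊔ Q) (R ⊔ Q),
      (∀ (x : S) (hx : x ∈ P), (ψ ⟨x, le_sup_left (a := P) hx⟩ : S) = φ ⟨x, hx⟩) ∧
      ∀ x : (P ⊔ Q : Subgroup S), (x : S) ∈ Q → (ψ x : S) ∈ Q := by
  obtain ⟨ψ, hψ, h1, h2⟩ := hQ.2 P R φ hφ
  refine ⟨ψ, hψ, h1, fun x hx => ?_⟩
  have h3 : (ψ x : S) ∈ ((Q.subgroupOf (P ⊔ Q)).map ψ).map (R ⊔ Q).subtype := ⟨ψ x, ⟨x, hx, rfl⟩, rfl⟩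
  rwa [h2] at h3

lemma IsNormal.apply_mem (hQ : F.IsNormal Q) {P R : Subgroup S} {φ : P →* R} (hφ : φ ∈ F.Hom P R)
    (x : P) (hx : (x : S) ∈ Q) : (φ x : S) ∈ Q := by
  obtain ⟨ψ, -, h1, h2⟩ := hQ.exists_extension hφ
  rw [← h1 x x.2]
  exact h2 _ hx

/-- Subgroups that contain a centric normal subgroup are centric. -/
lemma IsNormal.isCentric_of_le [Finite S] (hQ : F.IsNormal Q) (hc : F.IsCentric Q) {P : Subgroup S} (hP : Q ≤ P) :
    F.IsCentric P := by
  rintro R ⟨e, he⟩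
  -- `e` maps `Q` injectively into `Q`, hence onto it by finiteness.
  have hQR : Q ≤ R := fun x hx => by
    let f : Q → Q := fun y => ⟨e ⟨y, hP y.2⟩, hQ.apply_mem he.1 ⟨y, hP y.2⟩ y.2⟩
    have hf : Function.Injective f := fun y z hyz => by
      have h := e.injective (a₁ := ⟨y, hP y.2⟩) (a₂ := ⟨z, hP z.2⟩)
        (Subtype.ext (congrArg (fun q : Q => (q : S)) hyz))
      exact Subtype.ext (congrArg (fun q : P => (q : S)) h)
    obtain ⟨y, hy⟩ := Finite.surjective_of_injective hf ⟨x, hx⟩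
    rw [show x = e ⟨y, hP y.2⟩ from (congrArg Subtype.val hy).symm]
    exact (e _).2
  have hQc := hc Q ⟨MulEquiv.refl _, F.conj_mem _ 1 fun x => by simp, F.conj_mem _ 1 fun x => by simp⟩
  ext x
  constructor
  · intro hx
    have hxQ : x ∈ Q := by
      have : x ∈ Subgroup.centralizer (Q : Set S) := Subgroup.centralizer_le hQR hx
      rw [hQc] at this
      obtain ⟨y, -, rfl⟩ := this
      exact y.2
    refine ⟨⟨x, hQR hxQ⟩, ?_, rfl⟩
    rw [SetLike.mem_coe, Subgroup.mem_center_iff]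
    intro y
    exact Subtype.ext (Subgroup.mem_centralizer_iff.1 hx y y.2)
  · rintro ⟨y, hy, rfl⟩
    rw [Subgroup.mem_centralizer_iff]
    intro z hz
    exact congrArg Subtype.val (Subgroup.mem_center_iff.1 hy ⟨z, hz⟩)

lemma IsCentric.mem_of_mem_centralizer (hc : F.IsCentric Q) {z : S}
    (hz : z ∈ Subgroup.centralizer (Q : Set S)) : z ∈ Q := by
  rw [hc Q ⟨MulEquiv.refl _, F.conj_mem _ 1 fun x => by simp, F.conj_mem _ 1 fun x => by simp⟩] at hz
  obtain ⟨y, -, rfl⟩ := hz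
  exact y.2

end FusionSystem

/-! ### Extension and restriction in a linking system, and the automorphism group of a normal
centric subgroup. -/

namespace LinkingSystem
open CategoryTheory
variable {S : Type u} [Group S] {F : FusionSystem S} [Category.{u} F.Centric]
  (L : LinkingSystem F)

/-- The inclusion morphism `δ(1)`. -/
def inclusion {P R : F.Centric} (h : P.toSubgroup ≤ R.toSubgroup) : P ⟶ R :=
  L.δ P R 1 fun x hx => by simpa using h hx

lemma π_inclusion {P R : F.Centric} (h : P.toSubgroup ≤ R.toSubgroup) (x : P.toSubgroup) :
    (L.π (L.inclusion h) x : S) = x := by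
  rw [inclusion, L.π_δ]; simp

lemma inclusion_comp_δ {P R : F.Centric} (h : P.toSubgroup ≤ R.toSubgroup) (g : S) (hP) (hR) :
    L.inclusion h ≫ L.δ R R g hR = L.δ P P g hP ≫ L.inclusion h := by
  have h3 : ∀ x ∈ P.toSubgroup, g * x * g⁻¹ ∈ R.toSubgroup := fun x hx => h (hP x hx)
  have h1 := L.δ_mul P R R 1 g (fun x hx => by simpa using h hx) hR (by simpa using h3)
  have h2 := L.δ_mul P P R g 1 hP (fun x hx => by simpa using h hx) (by simpa using h3)
  simp only [mul_one, one_mul] at h1 h2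
  exact h1.symm.trans h2

lemma inclusion_comp_incl [Finite S] {P R : F.Centric} (h : P.toSubgroup ≤ R.toSubgroup) :
    L.inclusion h ≫ L.incl R = L.incl P := by
  have h1 := L.δ_mul P R F.centricTop 1 1 (fun x hx => by simpa using h hx)
    (fun _ _ => Subgroup.mem_top _) (fun _ _ => Subgroup.mem_top _)
  simp only [mul_one] at h1
  exact h1.symm

lemma ω_inclusion [Finite S] {P R : F.Centric} (h : P.toSubgroup ≤ R.toSubgroup) : L.ω (L.inclusion h) = 1 := by
  have := congrArg L.ω (L.inclusion_comp_incl h)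
  rwa [L.ω_comp, L.ω_incl, L.ω_incl, one_mul] at this

/-- A factorization of the underlying homomorphism through an inclusion lifts to the linking
system. -/
lemma exists_comp_inclusion_eq {P R R' : F.Centric} (h : R'.toSubgroup ≤ R.toSubgroup) (ψ : P ⟶ R)
    (hψ : ∀ x, (L.π ψ x : S) ∈ R'.toSubgroup) : ∃ χ : P ⟶ R', χ ≫ L.inclusion h = ψ := by
  obtain ⟨φ, hφ, hφψ⟩ := F.exists_codRestrict (L.π_mem ψ) hψ
  obtain ⟨χ, hχ⟩ := L.surjective P.isFullyCentralized φ hφ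
  -- The lift is correct only up to an element of the centralizer of `P`; precomposing with that
  -- element repairs it.
  obtain ⟨g, hg, hg', h1⟩ := (L.orbit P.isFullyCentralized (χ ≫ L.inclusion h) ψ).1 (by
    ext x
    rw [L.π_comp, MonoidHom.comp_apply, L.π_inclusion, hχ, hφψ])
  exact ⟨L.δ P P g hg' ≫ χ, by rw [h1, Category.assoc]⟩

/-- An extension of the underlying homomorphism lifts to the linking system. -/
lemma exists_inclusion_comp_eq {P P' R : F.Centric} (h : P.toSubgroup ≤ P'.toSubgroup) (ψ : P ⟶ R)
    {φ : P'.toSubgroup →* R.toSubgroup} (hφ : φ ∈ F.Hom P'.toSubgroup R.toSubgroup)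
    (hφψ : ∀ x : P.toSubgroup, (φ ⟨x, h x.2⟩ : S) = L.π ψ x) :
    ∃ χ : P' ⟶ R, L.inclusion h ≫ χ = ψ := by
  obtain ⟨χ, hχ⟩ := L.surjective P'.isFullyCentralized φ hφ
  obtain ⟨g, hg, hg', h1⟩ := (L.orbit P.isFullyCentralized (L.inclusion h ≫ χ) ψ).1 (by
    ext x
    rw [L.π_comp, MonoidHom.comp_apply, hχ, ← hφψ]
    congr 2
    exact Subtype.ext (L.π_inclusion h x))
  -- Since `P` is centric the correcting element lies in `P`, so it also acts on `P'` and the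
  -- correction extends.
  have hgP : g ∈ P.toSubgroup := P.isCentric.mem_of_mem_centralizer hg
  have hg'' : ∀ x ∈ P'.toSubgroup, g * x * g⁻¹ ∈ P'.toSubgroup := fun x hx =>
    mul_mem (mul_mem (h hgP) hx) (inv_mem (h hgP))
  exact ⟨L.δ P' P' g hg'' ≫ χ, by
    rw [h1, ← Category.assoc, ← Category.assoc, L.inclusion_comp_δ h g hg' hg'']⟩

/-- After applying `π`, the two morphisms can differ only by an element of the centralizer of `P`,
and the free action forces it to be `1`. -/
lemma comp_inclusion_injective {P R R' : F.Centric} (h : R'.toSubgroup ≤ R.toSubgroup)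
    {χ χ' : P ⟶ R'} (hχ : χ ≫ L.inclusion h = χ' ≫ L.inclusion h) : χ = χ' := by
  obtain ⟨g, hg, hg', rfl⟩ := (L.orbit P.isFullyCentralized χ χ').1 (by
    ext x
    have := congrArg (fun ψ => (L.π ψ x : S)) hχ
    rwa [L.π_comp, L.π_comp, MonoidHom.comp_apply, MonoidHom.comp_apply, L.π_inclusion,
      L.π_inclusion] at this)
  have h1 : g = 1 := by
    refine L.free P.isFullyCentralized (χ ≫ L.inclusion h) g hg' hg ?_
    rw [← Category.assoc]; exact hχ.symm
  subst h1
  rw [L.δ_one, Category.id_comp]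

lemma isIso_δ (P : F.Centric) (g : S) (h : ∀ x ∈ P.toSubgroup, g * x * g⁻¹ ∈ P.toSubgroup)
    (h' : ∀ x ∈ P.toSubgroup, g⁻¹ * x * g⁻¹⁻¹ ∈ P.toSubgroup) : IsIso (L.δ P P g h) := by
  refine ⟨L.δ P P g⁻¹ h', ?_, ?_⟩
  · rw [← L.δ_mul P P P g g⁻¹ h h' (by simp)]
    simp only [inv_mul_cancel, L.δ_one]
  · rw [← L.δ_mul P P P g⁻¹ g h' h (by simp)]
    simp only [mul_inv_cancel, L.δ_one]

lemma isIso_of_π_eq_id {P : F.Centric} (χ : P ⟶ P) (hχ : L.π χ = MonoidHom.id _) : IsIso χ := by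
  obtain ⟨g, hg, hg', h1⟩ := (L.orbit P.isFullyCentralized (𝟙 P) χ).1 (by rw [L.π_id, hχ])
  have hgP : g ∈ P.toSubgroup := P.isCentric.mem_of_mem_centralizer hg
  rw [h1, Category.comp_id]
  exact L.isIso_δ P g hg' fun x hx =>
    mul_mem (mul_mem (inv_mem hgP) hx) (inv_mem (inv_mem hgP))

/-- Endomorphisms in a linking system are invertible. -/
lemma isIso_of_end [Finite S] (L : LinkingSystem F) {P : F.Centric} (χ : P ⟶ P) : IsIso χ := by
  have hb : Function.Bijective (L.π χ) :=
    ⟨F.injective (L.π_mem χ), Finite.surjective_of_injective (F.injective (L.π_mem χ))⟩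
  let e : P.toSubgroup ≃* P.toSubgroup := MulEquiv.ofBijective (L.π χ) hb
  have he : F.IsIso e := F.isIso_of_mem (L.π_mem χ)
  -- A lift of the inverse in `F` need not be inverse to `χ`, but both composites lie over the
  -- identity and are therefore invertible.
  obtain ⟨χ', hχ'⟩ := L.surjective P.isFullyCentralized _ he.2
  have h1 : IsIso (χ ≫ χ') := L.isIso_of_π_eq_id _ (by
    rw [L.π_comp, hχ']
    exact MonoidHom.ext e.symm_apply_apply)
  have h2 : IsIso (χ' ≫ χ) := L.isIso_of_π_eq_id _ (by
    rw [L.π_comp, hχ']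
    exact MonoidHom.ext e.apply_symm_apply)
  have h3 : χ ≫ χ' ≫ inv (χ ≫ χ') = 𝟙 _ := by rw [← Category.assoc, IsIso.hom_inv_id]
  have h4 : (inv (χ' ≫ χ) ≫ χ') ≫ χ = 𝟙 _ := by rw [Category.assoc, IsIso.inv_hom_id]
  have h5 : inv (χ' ≫ χ) ≫ χ' = χ' ≫ inv (χ ≫ χ') := by
    rw [← Category.comp_id (inv (χ' ≫ χ) ≫ χ'), ← h3, ← Category.assoc _ χ, h4, Category.id_comp]
  exact ⟨χ' ≫ inv (χ ≫ χ'), h3, by rw [← h5, h4]⟩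

/-- The homomorphism from the normalizer to the automorphism group in a linking system, for a normal
subgroup. -/
def toAut [Finite S] (P : F.Centric) (hP : P.toSubgroup.Normal) : S →* Aut P where
  toFun s := @asIso _ _ _ _ (L.δ P P s fun x hx => hP.conj_mem x hx s) (L.isIso_of_end _)
  map_one' := Iso.ext (L.δ_one _ _)
  map_mul' _ _ := Iso.ext (L.δ_mul _ _ _ _ _ _ _ _)

/-- The homomorphism from an automorphism group in a linking system to its fundamental group. -/
def ωAut [Finite S] (P : F.Centric) : Aut P →* L.Pi where
  toFun g := L.ω g.hom
  map_one' := L.ω_id P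
  map_mul' g h := L.ω_comp h.hom g.hom

lemma ωAut_comp_toAut [Finite S] (P : F.Centric) (hP : P.toSubgroup.Normal) :
    (L.ωAut P).comp (L.toAut P hP) = L.fromS :=
  MonoidHom.ext fun s => L.ω_δ P s _

/-- This is axiom (C): morphisms of the fusion system on `P` become conjugations in the automorphism
group. -/
lemma toAut_π [Finite S] (P : F.Centric) (hP : P.toSubgroup.Normal) (g : Aut P) (u : P.toSubgroup) :
    L.toAut P hP (L.π g.hom u) = g * L.toAut P hP u * g⁻¹ := by
  rw [eq_mul_inv_iff_mul_eq]
  exact Iso.ext (L.δ_comp g.hom u _ _)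

/-- If `δ(s)` is the identity, then `s` centralizes `P` by axiom (B), and freeness in axiom (A)
gives `s = 1`. -/
lemma toAut_injective [Finite S] (P : F.Centric) (hP : P.toSubgroup.Normal) :
    Function.Injective (L.toAut P hP) := by
  rw [injective_iff_map_eq_one]
  intro s hs
  have h1 : L.δ P P s (fun x hx => hP.conj_mem x hx s) = 𝟙 P := congrArg Iso.hom hs
  refine L.free P.isFullyCentralized (𝟙 P) s _ ?_ (by rw [h1, Category.comp_id])
  rw [Subgroup.mem_centralizer_iff]
  intro x hx
  have h2 := L.π_δ P P s (fun x hx => hP.conj_mem x hx s) ⟨x, hx⟩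
  rw [h1, L.π_id] at h2
  exact (mul_inv_eq_iff_eq_mul.1 h2.symm).symm

/-- An automorphism that commutes with `P` lies over the identity of `P`, so it comes from the
centralizer of `P` in `S`, which is contained in `P`. In the model this says that `P` contains its
own centralizer. -/
lemma exists_toAut_eq [Finite S] (P : F.Centric) (hP : P.toSubgroup.Normal) (g : Aut P)
    (hg : ∀ u ∈ P.toSubgroup, g * L.toAut P hP u = L.toAut P hP u * g) :
    ∃ z ∈ P.toSubgroup, L.toAut P hP z = g := by
  obtain ⟨z, hz, hz', h1⟩ := (L.orbit P.isFullyCentralized (𝟙 P) g.hom).1 (by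
    ext u
    have h2 := L.toAut_π P hP g u
    rw [hg u u.2, mul_inv_cancel_right] at h2
    rw [L.π_id, L.toAut_injective P hP h2]
    rfl)
  refine ⟨z, P.isCentric.mem_of_mem_centralizer hz, Iso.ext ?_⟩
  rw [h1, Category.comp_id]
  rfl

/-- Each morphism of the linking system is, up to extension and restriction, an automorphism of a
given centric normal subgroup. -/
lemma exists_aut [Finite S] (Q : F.Centric) (hQ : F.IsNormal Q.toSubgroup) {P : F.Centric}
    (ψ : P ⟶ F.centricTop) : ∃ g : Aut Q, L.ωAut Q g = L.ω ψ ∧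
      ∀ u : P.toSubgroup, L.toAut Q hQ.normal (L.π ψ u) = g * L.toAut Q hQ.normal u * g⁻¹ := by
  obtain ⟨φ, hφ, hφψ, hφQ⟩ := hQ.exists_extension (L.π_mem ψ)
  let P' : F.Centric := ⟨P.toSubgroup ⊔ Q.toSubgroup, hQ.isCentric_of_le Q.isCentric le_sup_right⟩
  have hPP' : P.toSubgroup ≤ P'.toSubgroup := le_sup_left
  have hQP' : Q.toSubgroup ≤ P'.toSubgroup := le_sup_right
  obtain ⟨φ', hφ', hφφ'⟩ := F.exists_codRestrict hφ (R' := ⊤) fun _ => Subgroup.mem_top _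
  obtain ⟨ψ', rfl⟩ := L.exists_inclusion_comp_eq hPP' ψ hφ' fun x => by
    rw [hφφ', ← hφψ x x.2]
  have hQt : Q.toSubgroup ≤ F.centricTop.toSubgroup := le_top
  -- The extension to `PQ` preserves `Q`, so its restriction to `Q` factors through an endomorphism
  -- of `Q`. None of these changes affects `ω`, which is `1` on inclusions.
  obtain ⟨χ, hχ⟩ := L.exists_comp_inclusion_eq hQt (L.inclusion hQP' ≫ ψ') fun x => by
    rw [L.π_comp, MonoidHom.comp_apply]
    exact hQ.apply_mem (L.π_mem ψ') _ (by rw [L.π_inclusion]; exact x.2)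
  obtain ⟨g, rfl⟩ : ∃ g : Aut Q, g.hom = χ := ⟨@asIso _ _ _ _ χ (L.isIso_of_end χ), rfl⟩
  refine ⟨g, ?_, fun u => ?_⟩
  · have h1 := congrArg L.ω hχ
    rw [L.ω_comp, L.ω_inclusion, one_mul, L.ω_comp, L.ω_inclusion, mul_one] at h1
    rw [L.ω_comp, L.ω_inclusion, mul_one]
    exact h1
  · rw [eq_mul_inv_iff_mul_eq]
    -- The conjugation formula is checked after composition with the inclusion of `Q` in `S`, where
    -- axiom (C) for the extended morphism applies.
    refine Iso.ext (L.comp_inclusion_injective hQt ?_)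
    change (g.hom ≫ L.δ Q Q _ _) ≫ _ = (L.δ Q Q _ _ ≫ g.hom) ≫ _
    have hu : L.π (L.inclusion hPP' ≫ ψ') u = L.π ψ' ⟨u, hPP' u.2⟩ := by
      rw [L.π_comp, MonoidHom.comp_apply]
      exact congrArg _ (Subtype.ext (L.π_inclusion hPP' u))
    have h1 := L.δ_comp ψ' ⟨u, hPP' u.2⟩
      (fun x hx => mul_mem (mul_mem (hPP' u.2) hx) (inv_mem (hPP' u.2))) fun _ _ => Subgroup.mem_top _
    rw [Category.assoc, ← L.inclusion_comp_δ hQt _ _ fun _ _ => Subgroup.mem_top _, ← Category.assoc, hχ,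
      Category.assoc, hu, h1, ← Category.assoc, L.inclusion_comp_δ hQP' _ fun x hx =>
      hQ.normal.conj_mem x hx u, Category.assoc, ← hχ, ← Category.assoc]

end LinkingSystem

end

/-! ### The components of a minimal characteristic biset. -/

section

lemma mem_graphSubgroup {S : Type u} [Group S] {P R : Subgroup S} {φ : P →* R} {s t : S} :
    (s, t) ∈ graphSubgroup P φ ↔ ∃ h : s ∈ P, (φ ⟨s, h⟩ : S) = t := by
  constructor
  · rintro ⟨u, hu⟩
    obtain ⟨rfl, rfl⟩ := Prod.mk.inj hu
    exact ⟨u.2, rfl⟩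
  · rintro ⟨h, rfl⟩
    exact ⟨⟨s, h⟩, rfl⟩

lemma card_graphSubgroup {S : Type u} [Group S] {P R : Subgroup S} (φ : P →* R) :
    Nat.card (graphSubgroup P φ) = Nat.card P := by
  refine (Nat.card_congr (MonoidHom.ofInjective (f := P.subtype.prod (R.subtype.comp φ)) ?_).toEquiv).symm
  intro x y hxy
  exact Subtype.ext (congrArg Prod.fst hxy)

/-- If the cardinalities of all orbits are divisible by `d`, so is that of the set. -/
lemma dvd_card_of_forall_dvd_card_orbit {G : Type*} [Group G] {X : Type*} [MulAction G X] [Finite X] (d : ℕ)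
    (h : ∀ x : X, d ∣ Nat.card (MulAction.orbit G x)) : d ∣ Nat.card X := by
  have := Fintype.ofFinite (MulAction.orbitRel.Quotient G X)
  rw [Nat.card_congr (MulAction.selfEquivSigmaOrbits G X), Nat.card_sigma]
  exact Finset.dvd_sum fun o _ => h o.out

namespace FusionSystem

variable {S : Type u} [Group S] {F : FusionSystem S} {Ω : Type v} [MulAction (S × S) Ω]
  {Q : Subgroup S}

/-- The points whose stabilizer contains the graph of a map on the normal subgroup `Q`. -/
def normalPart (Q : Subgroup S) [hQ : Q.Normal] (Ω : Type v) [MulAction (S × S) Ω] : SubMulAction (S × S) Ω where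
  carrier := {x | ∀ u ∈ Q, ∃ t ∈ Q, (u, t) • x = x}
  smul_mem' := by
    rintro ⟨s, t⟩ x hx u hu
    obtain ⟨v, hv, h⟩ := hx _ (hQ.conj_mem' u hu s)
    refine ⟨t * v * t⁻¹, hQ.conj_mem v hv t, ?_⟩
    conv_rhs => rw [← h]
    rw [smul_smul, smul_smul]
    simp [mul_assoc]

lemma le_of_mem_normalPart [Q.Normal] {x : Ω} (hx : x ∈ normalPart Q Ω) {P R : Subgroup S} {φ : P →* R}
    (h : MulAction.stabilizer (S × S) x = graphSubgroup P φ) : Q ≤ P := by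
  intro u hu
  obtain ⟨t, -, ht⟩ := hx u hu
  have h1 : (u, t) ∈ MulAction.stabilizer (S × S) x := ht
  rw [h, mem_graphSubgroup] at h1
  exact h1.1

/-- Together with `le_of_mem_normalPart`, this identifies `normalPart` of a generated biset as the
union of the components `[P, φ]` with `Q ≤ P`. -/
lemma IsNormal.mem_normalPart_of_le [Q.Normal] (hQ : F.IsNormal Q) {x : Ω} {P R : Subgroup S} {φ : P →* R}
    (hφ : φ ∈ F.Hom P R)
    (h : MulAction.stabilizer (S × S) x = graphSubgroup P φ) (hP : Q ≤ P) : x ∈ normalPart Q Ω := by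
  intro u hu
  refine ⟨φ ⟨u, hP hu⟩, hQ.apply_mem hφ _ hu, ?_⟩
  have h1 : (u, (φ ⟨u, hP hu⟩ : S)) ∈ MulAction.stabilizer (S × S) x := by
    rw [h, mem_graphSubgroup]
    exact ⟨hP hu, rfl⟩
  exact h1

lemma card_orbit_mul_card [Finite S] {x : Ω} {P R : Subgroup S} {φ : P →* R}
    (h : MulAction.stabilizer (S × S) x = graphSubgroup P φ) :
    Nat.card (MulAction.orbit (S × S) x) = Nat.card S * P.index := by
  have h1 : Nat.card (MulAction.orbit (S × S) x) = (graphSubgroup P φ).index := by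
    rw [← h, MulAction.index_stabilizer, Nat.card_coe_set_eq]
  have h2 := (graphSubgroup P φ).card_mul_index
  rw [card_graphSubgroup, Nat.card_prod, ← h1] at h2
  have h3 := P.card_mul_index
  refine Nat.eq_of_mul_eq_mul_left (Nat.card_pos (α := P)) ?_
  rw [h2, ← h3]
  ring

lemma IsGenerated.subMulAction (h : F.IsGenerated Ω) (T : SubMulAction (S × S) Ω) :
    F.IsGenerated T := fun x => by
  obtain ⟨P, φ, hφ, h⟩ := h x
  refine ⟨P, φ, hφ, ?_⟩
  rw [← h, SubMulAction.stabilizer_of_subMul]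

lemma card_dvd_card [Finite S] [Finite Ω] (h : F.IsGenerated Ω) : Nat.card S ∣ Nat.card Ω :=
  dvd_card_of_forall_dvd_card_orbit (G := S × S) _ fun x => by
    obtain ⟨P, φ, -, hx⟩ := h x
    rw [card_orbit_mul_card hx]
    exact dvd_mul_right _ _

/-- Morphisms defined on all of `Q` extend to the product with `Q`, up to the target. -/
lemma IsNormal.exists_extension_top (hQ : F.IsNormal Q) {P : Subgroup S} {φ : P →* (⊤ : Subgroup S)}
    (hφ : φ ∈ F.Hom P ⊤) : ∃ ψ ∈ F.Hom (P ⊔ Q) ⊤,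
      ∀ (x : P), (ψ ⟨x, le_sup_left (a := P) x.2⟩ : S) = φ x := by
  obtain ⟨ψ, hψ, h1, -⟩ := hQ.exists_extension hφ
  obtain ⟨ψ', hψ', h2⟩ := F.exists_codRestrict hψ (R' := ⊤) fun _ => Subgroup.mem_top _
  exact ⟨ψ', hψ', fun x => (h2 _).trans (h1 x x.2)⟩

lemma IsNormal.exists_apply_eq [Finite S] (hQ : F.IsNormal Q) {P R : Subgroup S} {φ : P →* R}
    (hφ : φ ∈ F.Hom P R) (hP : Q ≤ P) {v : S} (hv : v ∈ Q) : ∃ u : P, (u : S) ∈ Q ∧ (φ u : S) = v := by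
  let f : Q → Q := fun y => ⟨φ ⟨y, hP y.2⟩, hQ.apply_mem hφ ⟨y, hP y.2⟩ y.2⟩
  have hf : Function.Injective f := fun y z hyz => by
    have h := F.injective hφ (a₁ := ⟨y, hP y.2⟩) (a₂ := ⟨z, hP z.2⟩)
      (Subtype.ext (congrArg (fun q : Q => (q : S)) hyz))
    exact Subtype.ext (congrArg (fun q : P => (q : S)) h)
  obtain ⟨y, hy⟩ := Finite.surjective_of_injective hf ⟨v, hv⟩
  exact ⟨⟨y, hP y.2⟩, y.2, congrArg (fun q : Q => (q : S)) hy⟩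

/-- A bijection that maps a finite subset to itself restricts to a bijection. -/
lemma exists_equiv_restrict {X : Type*} [Finite X] (e : X ≃ X) (s : Set X) (h : ∀ x ∈ s, e x ∈ s) :
    ∃ e' : s ≃ s, ∀ x, (e' x : X) = e x := by
  have hi : Function.Injective (fun x : s => (⟨e x, h x x.2⟩ : s)) := fun x y hxy =>
    Subtype.ext (e.injective (congrArg (fun z : s => (z : X)) hxy))
  exact ⟨Equiv.ofBijective _ ⟨hi, Finite.surjective_of_injective hi⟩, fun x => rfl⟩

/-- Stability survives because each `φ` extends to `PQ` with `Q` mapped to itself, and the bijection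
belonging to the extension preserves the condition that defines `normalPart`. Every discarded orbit
has `|S|·[S : P]` points with `P` proper, so the complement contributes a multiple of `p` to
`|Ω|/|S|`. -/
lemma IsNormal.isCharacteristic_normalPart [Finite S] {p : ℕ} [Fact p.Prime] (hS : IsPGroup p S)
    [Q.Normal] (hQ : F.IsNormal Q) (hΩ : F.IsCharacteristic Ω p) :
    F.IsCharacteristic (normalPart Q Ω) p := by
  have := hΩ.finite
  refine ⟨inferInstance, fun s x h => hΩ.leftFree s x (congrArg Subtype.val h),
    hΩ.generated.subMulAction _,
    fun P φ hφ => ?_, fun P φ hφ => ?_, ?_⟩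
  · obtain ⟨ψ, hψ, hφψ⟩ := hQ.exists_extension_top hφ
    obtain ⟨e, he⟩ := hΩ.leftStable _ ψ hψ
    obtain ⟨e', he'⟩ := exists_equiv_restrict e (normalPart Q Ω : Set Ω) fun x hx v hv => by
      obtain ⟨u, hu, rfl⟩ := hQ.exists_apply_eq hψ le_sup_right hv
      obtain ⟨t, ht, h⟩ := hx u hu
      exact ⟨t, ht, by rw [← he, h]⟩
    refine ⟨e', fun u s x => Subtype.ext ?_⟩
    rw [he', SubMulAction.val_smul, SubMulAction.val_smul, he', ← hφψ]
    exact he ⟨u, _⟩ s x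
  · obtain ⟨ψ, hψ, hφψ⟩ := hQ.exists_extension_top hφ
    obtain ⟨e, he⟩ := hΩ.rightStable _ ψ hψ
    obtain ⟨e', he'⟩ := exists_equiv_restrict e (normalPart Q Ω : Set Ω) fun x hx u hu => by
      obtain ⟨t, ht, h⟩ := hx u hu
      have ht' : t ∈ P ⊔ Q := le_sup_right (a := P) ht
      exact ⟨ψ ⟨t, ht'⟩, hQ.apply_mem hψ _ ht, by rw [← he _ ⟨t, ht'⟩, h]⟩
    refine ⟨e', fun s u x => Subtype.ext ?_⟩
    rw [he', SubMulAction.val_smul, SubMulAction.val_smul, he', ← hφψ]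
    exact he s ⟨u, _⟩ x
  · intro hdvd
    refine hΩ.nondegenerate ?_
    let T : SubMulAction (S × S) Ω := (normalPart Q Ω)ᶜ
    have h1 : Nat.card S * p ∣ Nat.card T := by
      refine dvd_card_of_forall_dvd_card_orbit (G := S × S) _ fun x => ?_
      obtain ⟨P, φ, hφ, hx⟩ := hΩ.generated x
      have hx' : MulAction.stabilizer (S × S) x = graphSubgroup P φ := by
        rw [← hx, SubMulAction.stabilizer_of_subMul]
      rw [card_orbit_mul_card hx']
      refine mul_dvd_mul_left _ ?_
      obtain ⟨m, hm⟩ := hS.index P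
      rw [hm]
      refine dvd_pow_self p ?_
      rintro rfl
      -- Index `1` would give `P = S ≥ Q`, so that the point would lie in `normalPart`.
      rw [pow_zero, Subgroup.index_eq_one] at hm
      exact x.2 (hQ.mem_normalPart_of_le hφ hx (hm ▸ le_top))
    have h2 := Nat.mul_dvd_of_dvd_div (card_dvd_card (hΩ.generated.subMulAction (normalPart Q Ω))) hdvd
    have h3 : Nat.card (normalPart Q Ω) + Nat.card T = Nat.card Ω :=
      Set.ncard_add_ncard_compl (normalPart Q Ω : Set Ω)
    rw [← h3]
    exact Nat.dvd_div_of_mul_dvd (dvd_add h2 h1)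

lemma IsMinimalCharacteristic.isCentricGenerated [Finite S] {p : ℕ} [Fact p.Prime]
    (hS : IsPGroup p S) (hΩ : F.IsMinimalCharacteristic Ω p) (hQ : F.IsNormal Q) (hc : F.IsCentric Q) (x : Ω) :
    ∃ (P : F.Centric), ∃ φ ∈ F.Hom P.toSubgroup ⊤,
      Q ≤ P.toSubgroup ∧ MulAction.stabilizer (S × S) x = graphSubgroup P.toSubgroup φ := by
  have := hQ.normal
  obtain ⟨P, φ, hφ, h⟩ := hΩ.isCharacteristic.generated x
  have hx : x ∈ normalPart Q Ω := by
    rw [hΩ.eq_top _ (hQ.isCharacteristic_normalPart hS hΩ.isCharacteristic)]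
    trivial
  have hP := le_of_mem_normalPart hx h
  exact ⟨⟨P, hQ.isCentric_of_le hc hP⟩, φ, hφ, hP, h⟩

end FusionSystem

end

section

/-! ### The family of cosets attached to a biset and its invariance under translation. -/

section BisetSum

variable (S : Type u) [Group S] (Ω : Type v) [MulAction (S × S) Ω]

/-- The equivalence relation on a biset whose classes are the orbits of the right action. -/
def rightOrbitRel : Setoid Ω where
  r x y := ∃ t : S, ((1 : S), t) • x = y
  iseqv :=
    { refl := fun x => ⟨1, one_smul (S × S) x⟩
      symm := by
        rintro x _ ⟨t, rfl⟩
        exact ⟨t⁻¹, by simp [smul_smul, ← Prod.one_eq_mk]⟩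
      trans := by
        rintro x _ _ ⟨t, rfl⟩ ⟨t', rfl⟩
        exact ⟨t' * t, by simp [smul_smul]⟩ }

variable {S Ω}

lemma rightOrbitRel_mk_eq {x y : Ω} :
    (Quotient.mk (rightOrbitRel S Ω) x = Quotient.mk (rightOrbitRel S Ω) y) ↔ ∃ t : S, ((1 : S), t) • x = y :=
  Quotient.eq

/-- The right orbits in a component `[P, φ]` correspond to `S/P`; inversion turns the cosets `Pq`
that index the transfer into these. Thus the double sum over components and cosets becomes one sum
over right orbits of `Ω`. -/
lemma rightRel_quotient_bijective (P : MulAction.orbitRel.Quotient (S × S) Ω → Subgroup S)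
    (hP : ∀ o u, u ∈ P o ↔ ∃ t : S, (u, t) • o.out = o.out) :
    Function.Bijective (fun a : (Σ o, Quotient (QuotientGroup.rightRel (P o))) =>
      Quotient.mk (rightOrbitRel S Ω) ((a.2.out⁻¹, (1 : S)) • a.1.out)) := by
  constructor
  · rintro ⟨o, q⟩ ⟨o', q'⟩ h
    obtain ⟨t, ht⟩ := rightOrbitRel_mk_eq.1 h
    dsimp only at ht
    have ho : o = o' := by
      rw [← Quotient.out_eq o, ← Quotient.out_eq o']
      refine Quotient.sound (s := MulAction.orbitRel (S × S) Ω) (MulAction.orbitRel_apply.2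
        ⟨((q'.out⁻¹, (1 : S)) : S × S)⁻¹ * (((1 : S), t) * (q.out⁻¹, (1 : S))), ?_⟩) |>.symm
      dsimp only
      rw [mul_smul, mul_smul, ht, inv_smul_smul]
    subst ho
    have hq : q = q' := by
      rw [← Quotient.out_eq q, ← Quotient.out_eq q']
      refine Quotient.sound ?_
      refine QuotientGroup.rightRel_apply.2 ((hP _ _).2 ⟨t, ?_⟩)
      rw [smul_smul] at ht
      rw [← smul_left_cancel_iff ((q'.out⁻¹, (1 : S)) : S × S), ← ht, smul_smul]
      simp
    rw [hq]
  · intro y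
    induction y using Quotient.inductionOn with | h x =>
    obtain ⟨⟨s, t⟩, hst⟩ : ∃ g : S × S, g • (Quotient.mk (MulAction.orbitRel (S × S) Ω) x).out = x :=
      MulAction.orbitRel_apply.1 ((MulAction.orbitRel (S × S) Ω).symm' (Quotient.mk_out (s := MulAction.orbitRel (S × S) Ω) x))
    set o : MulAction.orbitRel.Quotient (S × S) Ω := Quotient.mk _ x
    refine ⟨⟨o, Quotient.mk _ s⁻¹⟩, ?_⟩
    have hq := QuotientGroup.rightRel_apply.1 (Quotient.mk_out (s := QuotientGroup.rightRel (P o)) s⁻¹)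
    obtain ⟨v, hv⟩ := (hP o _).1 hq
    refine rightOrbitRel_mk_eq.2 ⟨t * v, ?_⟩
    dsimp only
    conv_rhs => rw [← hst, ← hv]
    simp [smul_smul]

variable {G : Type*} [Group G] (j : S →* G) (Q : Subgroup S)

/-- The elements of `G` that induce by conjugation the map on `Q` given by the stabilizer of `x`. -/
def conjSet (x : Ω) : Set G := {g | ∀ u ∈ Q, ∀ t, (u, t) • x = x → g * j u = j t * g}

variable {j Q}

lemma conjSet_smul [hQ : Q.Normal] {x : Ω} {g : G} (hg : g ∈ conjSet j Q x) (s t : S) :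
    j t * g * (j s)⁻¹ ∈ conjSet j Q ((s, t) • x) := by
  intro u hu v hv
  have h := hg (s⁻¹ * u * s) (hQ.conj_mem' u hu s) (t⁻¹ * v * t) (by
    rw [← smul_left_cancel_iff ((s, t) : S × S), smul_smul]
    conv_rhs => rw [← hv]
    rw [smul_smul]
    simp [mul_assoc])
  simp only [map_mul, map_inv] at h
  calc j t * g * (j s)⁻¹ * j u = j t * (g * ((j s)⁻¹ * j u * j s)) * (j s)⁻¹ := by group
    _ = _ := by rw [h]; group

/-- Two elements of `conjSet j Q x` differ by the image of an element of `S`. -/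
lemma eq_mul_of_mem_conjSet {x : Ω} (hx : ∀ u ∈ Q, ∃ t : S, (u, t) • x = x)
    (hj : ∀ g : G, (∀ u ∈ Q, g * j u = j u * g) → ∃ z ∈ Q, j z = g) {g g' : G}
    (hg : g ∈ conjSet j Q x) (hg' : g' ∈ conjSet j Q x) : ∃ t, g' = j t * g := by
  -- Both elements induce the same map on `Q`, so their quotient centralizes `j(Q)` and lies in it;
  -- `g` carries it across to `j(S)`.
  obtain ⟨z, hz, h⟩ := hj (g⁻¹ * g') fun u hu => by
    obtain ⟨t, ht⟩ := hx u hu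
    have h1 := hg u hu t ht
    have h2 := hg' u hu t ht
    rw [mul_assoc, h2, ← mul_assoc, inv_mul_eq_iff_eq_mul.2 (eq_mul_inv_of_mul_eq h1.symm |>.trans (mul_assoc _ _ _))]
    group
  obtain ⟨t, ht⟩ := hx z hz
  exact ⟨t, by rw [← hg z hz t ht, h, mul_inv_cancel_left]⟩

/-- The set `conjSet j Q x` determines a coset `j(S)g` that depends only on the right orbit of `x`,
and either side is a sum over these orbits. Left stability along conjugation by `h⁻¹` permutes the
orbits, and the coset of `x` is that of `e x` times `h⁻¹`; reindexing by `e` absorbs the translation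
by `h`. -/
lemma sum_finsum_eq_of_conjSet [Finite S] [Finite Ω] [Q.Normal] {A : Type*} [AddCommMonoid A]
    [Fintype (MulAction.orbitRel.Quotient (S × S) Ω)]
    (hx : ∀ x : Ω, ∀ u ∈ Q, ∃ t : S, (u, t) • x = x)
    (hj : ∀ g : G, (∀ u ∈ Q, g * j u = j u * g) → ∃ z ∈ Q, j z = g)
    (hne : ∀ x : Ω, (conjSet j Q x).Nonempty)
    (hconj : ∀ h : G, ∃ (e : Ω ≃ Ω) (σ : Q → Q), (∀ u : Q, j (σ u) = h * j u * h⁻¹) ∧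
      ∀ (u : Q) (s : S) (x : Ω), e (((u : S), s) • x) = ((σ u : S), s) • e x)
    (P : MulAction.orbitRel.Quotient (S × S) Ω → Subgroup S)
    (hP : ∀ o u, u ∈ P o ↔ ∃ t : S, (u, t) • o.out = o.out)
    (g : MulAction.orbitRel.Quotient (S × S) Ω → G) (hg : ∀ o, g o ∈ conjSet j Q o.out)
    (Φ : G → A) (hΦ : ∀ s h, Φ (j s * h) = Φ h) (h : G) :
    ∑ o, ∑ᶠ q : Quotient (QuotientGroup.rightRel (P o)), Φ (g o * j q.out * h) =
      ∑ o, ∑ᶠ q : Quotient (QuotientGroup.rightRel (P o)), Φ (g o * j q.out) := by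
  classical
  have := Fintype.ofFinite (Quotient (rightOrbitRel S Ω))
  have := fun o => Fintype.ofFinite (Quotient (QuotientGroup.rightRel (P o)))
  choose f hf using hne
  have hval : ∀ Ψ : G → A, (∀ s h, Ψ (j s * h) = Ψ h) → ∀ (x : Ω) (g : G), g ∈ conjSet j Q x →
      Ψ (f (Quotient.mk (rightOrbitRel S Ω) x).out) = Ψ g := by
    intro Ψ hΨ x g hg
    obtain ⟨t, ht⟩ := rightOrbitRel_mk_eq.1 (Quotient.out_eq (Quotient.mk (rightOrbitRel S Ω) x))
    have h1 := conjSet_smul (hf (Quotient.mk (rightOrbitRel S Ω) x).out) 1 t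
    rw [ht] at h1
    obtain ⟨t', rfl⟩ := eq_mul_of_mem_conjSet (hx x) hj h1 hg
    simp [hΨ]
  have hsum : ∀ Ψ : G → A, (∀ s h, Ψ (j s * h) = Ψ h) →
      ∑ o, ∑ᶠ q : Quotient (QuotientGroup.rightRel (P o)), Ψ (g o * j q.out) =
        ∑ y : Quotient (rightOrbitRel S Ω), Ψ (f y.out) := by
    intro Ψ hΨ
    simp only [finsum_eq_sum_of_fintype]
    rw [← Fintype.sum_sigma' (f := fun o (q : Quotient (QuotientGroup.rightRel (P o))) => Ψ (g o * j q.out))]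
    refine Fintype.sum_bijective _ (rightRel_quotient_bijective P hP) _ _ fun a => ?_
    refine (hval Ψ hΨ _ _ ?_).symm
    simpa using conjSet_smul (hg a.1) a.2.out⁻¹ 1
  rw [hsum Φ hΦ, hsum (fun g => Φ (g * h)) fun s g => by rw [mul_assoc, hΦ]]
  obtain ⟨e, σ, hσ, he⟩ := hconj h⁻¹
  -- Nothing says that `σ` fixes `1`; comparison with the case `t = 1` eliminates `σ 1`.
  have he1 : ∀ (t : S) (x : Ω), e (((1 : S), t) • x) = ((1 : S), t) • e x := fun t x => by
    have hx1 : e ((1 : S × S) • x) = e x := by rw [one_smul]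
    have h1 := he 1 1 x
    have h2 := he 1 t x
    simp only [OneMemClass.coe_one] at h1 h2
    rw [h2]
    change e ((1 : S × S) • x) = _ at h1
    rw [one_smul] at h1
    conv_rhs => rw [h1]
    simp [smul_smul]
  refine Fintype.sum_equiv (Quotient.congr e fun x y => ?_) _ _ fun y => ?_
  · constructor
    · rintro ⟨t, rfl⟩
      exact ⟨t, (he1 t x).symm⟩
    · rintro ⟨t, ht⟩
      exact ⟨t, e.injective (by rw [he1, ht])⟩
  · induction y using Quotient.inductionOn with | h x =>
    rw [Quotient.congr_mk, hval Φ hΦ _ _ (hf (e x)), hval (fun g => Φ (g * h)) (fun s g => by rw [mul_assoc, hΦ]) x (f (e x) * h⁻¹)]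
    · simp
    · intro u hu t ht
      have h1 := hf (e x) (σ ⟨u, hu⟩) (σ ⟨u, hu⟩).2 t (by rw [← he ⟨u, hu⟩ t x, ht])
      rw [hσ] at h1
      simp only [inv_inv] at h1
      calc f (e x) * h⁻¹ * j u = f (e x) * (h⁻¹ * j u * h) * h⁻¹ := by group
        _ = _ := by rw [h1]; group

end BisetSum

end

/-! ### The map `Ω_*` and the stable elements. -/

section

open CategoryTheory

section

variable {k G S Γ : Type u} [CommRing k] [Group G] [Group S] [Group Γ] [Finite S] {j : S →* G}

/-- The image of `Hⁿ(G, M)` in `Hⁿ(S, M)`, for a `k[Γ]`-module `M` and homomorphisms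
`S → G → Γ`. -/
lemma exists_submodule_image (hj : Function.Injective j) (w : G →* Γ) (f : S →* Γ)
    (hf : w.comp j = f) (M : Rep.{u} k Γ) (n : ℕ) :
    ∃ W : Submodule k (groupCohomology (Rep.res f M) n),
      (∀ (P : Subgroup S) (φ : P →* S) (g : G), (∀ u : P, j (φ u) = g * j u * g⁻¹) →
        ∀ c : Rep.res φ (Rep.res f M) ⟶ Rep.res P.subtype (Rep.res f M),
          (∀ v : M.V, c.hom v = M.ρ (w g)⁻¹ v) → ∀ x ∈ W,
            (groupCohomology.map φ c n).hom x = (restriction P (Rep.res f M) n).hom x) ∧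
      ∀ {ι : Type v} [Fintype ι] (P : ι → Subgroup S) (φ : ∀ i, P i →* S) (g : ι → G),
        (∀ i (u : P i), j (φ i u) = g i * j u * (g i)⁻¹) →
        ∀ c : ∀ i, Rep.res (φ i) (Rep.res f M) ⟶ Rep.res (P i).subtype (Rep.res f M),
          (∀ i (v : M.V), (c i).hom v = M.ρ (w (g i))⁻¹ v) →
          (∀ Φ : G → M.V, (∀ s h, Φ (j s * h) = Φ h) → ∀ h,
            ∑ i, ∑ᶠ q : Quotient (QuotientGroup.rightRel (P i)), Φ (g i * j q.out * h) =
              ∑ i, ∑ᶠ q : Quotient (QuotientGroup.rightRel (P i)), Φ (g i * j q.out)) →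
          ∀ x, ∑ i, (transfer (P i) (Rep.res f M) n).hom
            ((groupCohomology.map (φ i) (c i) n).hom x) ∈ W := by
  -- The map `f` is a variable because `fromS` equals the composite through `G` only
  -- propositionally; after substitution the coefficients are visibly restricted from a `G`-module.
  subst hf
  refine ⟨LinearMap.range (groupCohomology.map j (𝟙 (Rep.res j (Rep.res w M))) n).hom, ?_, ?_⟩
  · rintro P φ g hφ c hc _ ⟨z, rfl⟩
    exact map_res_eq_restriction (N := Rep.res w M) hφ c
      (fun v => (hc v).trans (by rw [← map_inv]; rfl)) n z
  · intro ι _ P φ g hφ c hc H x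
    obtain ⟨z, hz⟩ := exists_sum_transfer_eq_map (N := Rep.res w M) hj P φ g hφ c
      (fun i v => (hc i v).trans (by rw [← map_inv]; rfl)) H n x
    exact ⟨z, hz.symm⟩

end

lemma isUnit_natCast_of_not_dvd {p : ℕ} [Fact p.Prime] {k : Type u} [CommRing k]
    [IsLocalization.AtPrime k (Ideal.span {(p : ℤ)})] {m : ℕ} (hm : ¬ p ∣ m) : IsUnit (m : k) := by
  have h := IsLocalization.map_units k (M := (Ideal.span {(p : ℤ)}).primeCompl)
    ⟨(m : ℤ), fun h => hm (Int.natCast_dvd_natCast.1 (Ideal.mem_span_singleton.1 h))⟩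
  simpa using h

lemma card_quotient_rightRel {S : Type u} [Group S] (P : Subgroup S) :
    Nat.card (Quotient (QuotientGroup.rightRel P)) = P.index :=
  Nat.card_congr (QuotientGroup.quotientRightRelEquivQuotientLeftRel P)

/-- A map with image in `V` that acts on `V` by an invertible scalar becomes idempotent with image
`V` after division by that scalar. -/
lemma isIdempotentElem_smul_and_range_eq {k A : Type*} [CommRing k] [AddCommGroup A] [Module k A]
    {E : Module.End k A} {V : Submodule k A} {c m : k} (hcm : c * m = 1) (hV : ∀ x, E x ∈ V)
    (hE : ∀ x ∈ V, E x = m • x) :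
    IsIdempotentElem (c • E) ∧ LinearMap.range (c • E) = V := by
  have h : ∀ x ∈ V, (c • E) x = x := fun x hx => by
    rw [LinearMap.smul_apply, hE x hx, smul_smul, hcm, one_smul]
  have h' : ∀ x, (c • E) x ∈ V := fun x => V.smul_mem c (hV x)
  refine ⟨LinearMap.ext fun x => h _ (h' x), le_antisymm ?_ fun x hx => ⟨x, h x hx⟩⟩
  rintro _ ⟨x, rfl⟩
  exact h' x

lemma mem_iff_exists_smul_eq {S : Type u} [Group S] {Ω : Type v} [MulAction (S × S) Ω] {P R : Subgroup S}
    {φ : P →* R} {x : Ω} (hx : MulAction.stabilizer (S × S) x = graphSubgroup P φ) {u : S} :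
    u ∈ P ↔ ∃ t : S, (u, t) • x = x := by
  simp_rw [← MulAction.mem_stabilizer_iff, hx, mem_graphSubgroup]
  exact ⟨fun h => ⟨_, h, rfl⟩, fun ⟨_, h, _⟩ => h⟩

namespace FusionSystem

lemma IsCentricGenerated.card_eq_sum_index {S : Type u} [Group S] [Finite S] {F : FusionSystem S}
    {Ω : Type v} [MulAction (S × S) Ω] [Finite Ω] [Fintype (MulAction.orbitRel.Quotient (S × S) Ω)]
    (hΩ : F.IsCentricGenerated Ω) :
    Nat.card Ω = Nat.card S * ∑ o : MulAction.orbitRel.Quotient (S × S) Ω,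
      (hΩ o.out).choose.toSubgroup.index := by
  rw [Nat.card_congr (MulAction.selfEquivSigmaOrbits (S × S) Ω), Nat.card_sigma, Finset.mul_sum]
  exact Finset.sum_congr rfl fun o _ =>
    card_orbit_mul_card (hΩ o.out).choose_spec.choose_spec.2

end FusionSystem

namespace LinkingSystem

variable {S : Type u} [Group S] [Finite S] {F : FusionSystem S} [Category.{u} F.Centric]
  (L : LinkingSystem F) {k : Type u} [CommRing k] {Ω : Type v} [MulAction (S × S) Ω]

variable (M : Rep.{u} k L.Pi) (n : ℕ)

lemma bisetMap_apply [Fintype (MulAction.orbitRel.Quotient (S × S) Ω)]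
    (hΩ : F.IsCentricGenerated Ω) (x : groupCohomology (L.resS M) n) :
    L.bisetMap M n hΩ x = ∑ o : MulAction.orbitRel.Quotient (S × S) Ω,
      (transfer (hΩ o.out).choose.toSubgroup (L.resS M) n).hom
        ((L.fusionPullback M n (hΩ o.out).choose_spec.choose
          (hΩ o.out).choose_spec.choose_spec.1).hom x) := by
  rw [bisetMap, finsum_eq_sum_of_fintype, LinearMap.sum_apply]
  rfl

/-- On a stable class each `φ^*` is a restriction, and transfer after restriction is multiplication
by the index. -/
lemma bisetMap_apply_of_mem_stable [Fintype (MulAction.orbitRel.Quotient (S × S) Ω)]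
    (hΩ : F.IsCentricGenerated Ω) {x : groupCohomology (L.resS M) n} (hx : x ∈ L.stable M n) :
    L.bisetMap M n hΩ x = ((∑ o : MulAction.orbitRel.Quotient (S × S) Ω,
      (hΩ o.out).choose.toSubgroup.index : ℕ) : k) • x := by
  rw [bisetMap_apply, Nat.cast_smul_eq_nsmul, Finset.sum_smul]
  refine Finset.sum_congr rfl fun o _ => ?_
  simp only [stable, Submodule.mem_iInf, LinearMap.mem_eqLocus] at hx
  rw [hx, transfer_restriction, card_quotient_rightRel]

/-- The values lie in the image `W` of the cohomology of the automorphism group of `Q`, and `W` is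
stable because every morphism of `L` to `S` is represented by an element of that group. -/
lemma bisetMap_mem_stable [Finite Ω] {Q : F.Centric} (hQ : F.IsNormal Q.toSubgroup) (hΩ : F.IsCentricGenerated Ω) (hleft : F.IsLeftStable Ω)
    (hx : ∀ x : Ω, ∀ u ∈ Q.toSubgroup, ∃ t : S, (u, t) • x = x)
    (x : groupCohomology (L.resS M) n) : L.bisetMap M n hΩ x ∈ L.stable M n := by
  have := Fintype.ofFinite (MulAction.orbitRel.Quotient (S × S) Ω)
  have := hQ.normal
  obtain ⟨W, hW, hW'⟩ := exists_submodule_image (L.toAut_injective Q hQ.normal) (L.ωAut Q) _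
    (L.ωAut_comp_toAut Q hQ.normal) M n
  have hWs : W ≤ L.stable M n := by
    intro y hy
    simp only [stable, Submodule.mem_iInf, LinearMap.mem_eqLocus]
    intro P φ hφ
    obtain ⟨g, hg, hg'⟩ := L.exists_aut Q hQ
      (L.surjective (Q := F.centricTop) P.isFullyCentralized φ hφ).choose
    exact hW _ _ g hg' _ (fun v => by rw [hg]; rfl) y hy
  refine hWs ?_
  rw [bisetMap_apply]
  have hmor : ∀ (P : F.Centric) (φ : P.toSubgroup →* (⊤ : Subgroup S))
      (hφ : φ ∈ F.Hom P.toSubgroup ⊤), ∃ g : Aut Q,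
        L.ωAut Q g = L.ω (L.surjective (Q := F.centricTop) P.isFullyCentralized φ hφ).choose ∧
        ∀ u, L.toAut Q hQ.normal (φ u) = g * L.toAut Q hQ.normal u * g⁻¹ := fun P φ hφ => by
    obtain ⟨g, hg, hg'⟩ := L.exists_aut Q hQ
      (L.surjective (Q := F.centricTop) P.isFullyCentralized φ hφ).choose
    refine ⟨g, hg, fun u => ?_⟩
    rw [← hg', (L.surjective (Q := F.centricTop) P.isFullyCentralized φ hφ).choose_spec]
  have hconj : ∀ {P : F.Centric} {φ : P.toSubgroup →* (⊤ : Subgroup S)} {g : Aut Q} {y : Ω},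
      MulAction.stabilizer (S × S) y = graphSubgroup P.toSubgroup φ →
      (∀ u, L.toAut Q hQ.normal (φ u) = g * L.toAut Q hQ.normal u * g⁻¹) →
      g ∈ conjSet (L.toAut Q hQ.normal) Q.toSubgroup y := fun {P φ g y} hy hg u hu t ht => by
    have h1 : (u, t) ∈ MulAction.stabilizer (S × S) y := ht
    rw [hy, mem_graphSubgroup] at h1
    obtain ⟨h, rfl⟩ := h1
    rw [hg, inv_mul_cancel_right]
  choose g hg hg' using fun o : MulAction.orbitRel.Quotient (S × S) Ω =>
    hmor _ _ (hΩ o.out).choose_spec.choose_spec.1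
  refine hW' (fun o : MulAction.orbitRel.Quotient (S × S) Ω => (hΩ o.out).choose.toSubgroup)
    (fun o => (⊤ : Subgroup S).subtype.comp (L.π (L.surjective (Q := F.centricTop)
      (hΩ o.out).choose.isFullyCentralized _ (hΩ o.out).choose_spec.choose_spec.1).choose))
    g (fun o u => ?_) _ (fun o v => ?_) (fun Φ hΦ h => ?_) x
  · rw [← hg', MonoidHom.comp_apply, (L.surjective (Q := F.centricTop)
      (hΩ o.out).choose.isFullyCentralized _ (hΩ o.out).choose_spec.choose_spec.1).choose_spec]
    rfl
  · rw [hg]; rfl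
  · refine sum_finsum_eq_of_conjSet hx (fun g hg => L.exists_toAut_eq Q hQ.normal g hg)
      (fun y => ?_) (fun h => ?_) _ (fun o u => ?_) g
      (fun o => hconj (hΩ o.out).choose_spec.choose_spec.2 (hg' o)) Φ hΦ h
    · obtain ⟨P, φ, hφ, hy⟩ := hΩ y
      obtain ⟨g, -, hg⟩ := hmor P φ hφ
      exact ⟨g, hconj hy hg⟩
    · obtain ⟨φ, hφ, hφh⟩ := F.exists_codRestrict (R' := ⊤) (L.π_mem h.hom) fun _ => Subgroup.mem_top _
      obtain ⟨e, he⟩ := hleft _ φ hφ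
      refine ⟨e, L.π h.hom, fun u => L.toAut_π Q hQ.normal h u, fun u s y => ?_⟩
      rw [he, hφh]
    · exact mem_iff_exists_smul_eq (hΩ o.out).choose_spec.choose_spec.2

end LinkingSystem

end

end PLocal

end

theorem mainTheorem6
    {p : ℕ} [Fact p.Prime]
    -- a `p`-local finite group `(S, F, L)`
    {S : Type u} [Group S] [Finite S] (hS : IsPGroup p S)
    (F : PLocal.FusionSystem S) (hF : F.IsSaturated p)
    [CategoryTheory.Category.{u} F.Centric] (L : PLocal.LinkingSystem F)
    (hconstrained : F.IsConstrained)
    {Ω : Type v} [MulAction (S × S) Ω] (hΩ : F.IsMinimalCharacteristic Ω p)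
    -- the ring `ℤ_(p)`
    {k : Type u} [CommRing k] [IsLocalization.AtPrime k (Ideal.span {(p : ℤ)})] :
    -- `Ω` is a union of bisets `[P, φ]` with `P` centric, so that `Ω_*` is defined,
    -- and `c` is the element `|S| / |Ω|` of `ℤ_(p)`
    ∃ (hgen : F.IsCentricGenerated Ω) (c : k), c * (Nat.card Ω : k) = (Nat.card S : k) ∧
      ∀ (M : Rep.{u} k L.Pi) (n : ℕ),
        IsIdempotentElem (c • L.bisetMap M n hgen) ∧
        LinearMap.range (c • L.bisetMap M n hgen) = L.stable M n := by
  obtain ⟨Q, ⟨hQ, -⟩, hQc⟩ := hconstrained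
  have hP := hΩ.isCentricGenerated hS hQ hQc
  have hgen : F.IsCentricGenerated Ω := fun x => by
    obtain ⟨P, φ, hφ, -, h⟩ := hP x
    exact ⟨P, φ, hφ, h⟩
  have hfin := hΩ.isCharacteristic.finite
  have := Fintype.ofFinite (MulAction.orbitRel.Quotient (S × S) Ω)
  have hcard := hgen.card_eq_sum_index
  -- The sum of the indices is `|Ω|/|S|`. Inverting this integer, rather than `|Ω|` itself, keeps
  -- `c` in `ℤ_(p)`.
  have hunit : IsUnit ((∑ o : MulAction.orbitRel.Quotient (S × S) Ω,
      (hgen o.out).choose.toSubgroup.index : ℕ) : k) := by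
    refine PLocal.isUnit_natCast_of_not_dvd (p := p) fun h => hΩ.isCharacteristic.nondegenerate ?_
    rwa [hcard, Nat.mul_div_cancel_left _ Nat.card_pos]
  obtain ⟨c, hc⟩ := hunit.exists_left_inv
  refine ⟨hgen, c, ?_, fun M n => ?_⟩
  · rw [hcard, Nat.cast_mul, mul_left_comm, hc, mul_one]
  · refine PLocal.isIdempotentElem_smul_and_range_eq hc
      (L.bisetMap_mem_stable M n (Q := ⟨Q, hQc⟩) hQ hgen hΩ.isCharacteristic.leftStable
        fun x u hu => ?_) fun x => L.bisetMap_apply_of_mem_stable M n hgen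
    obtain ⟨P, φ, -, hQP, h⟩ := hP x
    exact (PLocal.mem_iff_exists_smul_eq h).1 (hQP hu)
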